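/- Let $\gamma=(1+\sqrt5)/2$. For a polynomial $P\in\mathbb{Z}[T]$ let $H(P)$ denote the maximum of the absolute values of its coefficients; for an algebraic number $\alpha\in\mathbb{C}$ let $H(\alpha)$ denote the height of its minimal polynomial over $\mathbb{Z}$. A real number $\xi$ is called extremal if $[\mathbb{Q}(\xi):\mathbb{Q}]>2$ and there is a constant $c>0$ such that, for every real $X\ge 1$, the system $$|x_0|\le X,\qquad |x_0\xi-x_1|\le cX^{-1/\gamma},\qquad |x_0\xi^2-x_2|\le cX^{-1/\gamma}$$ has a non-zero solution $(x_0,x_1,x_2)\in\mathbb{Z}^3$. For $n\ge1$ and $\xi\in\mathbb{R}$, let $w_n(\xi)$ be the supremum of the real numbers $w$ such that $0<|P(\xi)|\le H(P)^{-w}$ for infinitely many $P\in\mathbb{Z}[T]$ of degree at most $n$, and let $w_n^*(\xi)$ be the supremum of the real numbers $w$ such that $|\xi-\alpha|\le H(\alpha)^{-w-1}$ for infinitely many algebraic numbers $\alpha\in\mathbb{C}$ of degree at most $n$ over $\mathbb{Q}$. Theorem. Let $\xi$ be an extremal real number. Then there exist constants $c_1,c_2>0$ (depending on $\xi$) such that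 (i) there are infinitely many non-zero polynomials $P\in\mathbb{Z}[T]$ of degree at most $2$ with $|P(\xi)|\le c_1H(P)^{-\gamma^3}$; (ii) every non-zero polynomial $P\in\mathbb{Z}[T]$ of degree at most $2$ satisfies $|P(\xi)|>c_2H(P)^{-\gamma^3}$. Moreover, $w_2(\xi)=w_2^*(\xi)=\gamma^3$. -/

import Mathlib

open Polynomial

noncomputable section

/-- A real number `ξ` is extremal if `[ℚ(ξ) : ℚ] > 2` and if, for some constant `c > 0`, the system
`|x₀| ≤ X`, `|x₀ ξ - x₁| ≤ c X ^ (-1/γ)`, `|x₀ ξ² - x₂| ≤ c X ^ (-1/γ)`, where `γ` is the golden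
ratio, has a non-zero solution `(x₀, x₁, x₂) ∈ ℤ³` for each real number `X ≥ 1`. -/
def IsExtremal (ξ : ℝ) : Prop :=
  2 < Module.rank ℚ (IntermediateField.adjoin ℚ {ξ}) ∧
  ∃ c : ℝ, 0 < c ∧ ∀ X : ℝ, 1 ≤ X →
    ∃ x₀ x₁ x₂ : ℤ, (x₀, x₁, x₂) ≠ (0, 0, 0) ∧
      |(x₀ : ℝ)| ≤ X ∧
      |(x₀ : ℝ) * ξ - x₁| ≤ c * X ^ (-(1 / Real.goldenRatio)) ∧
      |(x₀ : ℝ) * ξ ^ 2 - x₂| ≤ c * X ^ (-(1 / Real.goldenRatio))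

/-- The height of an integer polynomial: the maximum of the absolute values of its
coefficients. -/
def polyHeight (P : ℤ[X]) : ℝ := P.supNorm

/-- The minimal polynomial over `ℤ` (up to sign) of an algebraic number `α`: the primitive integer
polynomial proportional to the minimal polynomial of `α` over `ℚ`. -/
def intMinpoly (α : ℂ) : ℤ[X] :=
  (IsLocalization.integerNormalization (nonZeroDivisors ℤ) (minpoly ℚ α)).primPart

/-- The height of an algebraic number: the height of its minimal polynomial over `ℤ`. -/
def algHeight (α : ℂ) : ℝ := polyHeight (intMinpoly α)

/-- Mahler's exponent `w_n(ξ)`: the supremum (in the extended reals) of the real numbers `w` such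
that `0 < |P(ξ)| ≤ H(P) ^ (-w)` for infinitely many integer polynomials `P` of degree
at most `n`. -/
def mahlerExponent (n : ℕ) (ξ : ℝ) : EReal :=
  ⨆ w ∈ {w : ℝ | {P : ℤ[X] | P.natDegree ≤ n ∧ 0 < |aeval ξ P| ∧
    |aeval ξ P| ≤ polyHeight P ^ (-w)}.Infinite}, (w : EReal)

/-- Koksma's exponent `w_n^*(ξ)`: the supremum (in the extended reals) of the real numbers `w` such
that `|ξ - α| ≤ H(α) ^ (-w - 1)` for infinitely many (complex) algebraic numbers `α` of degree
at most `n`. -/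
def koksmaExponent (n : ℕ) (ξ : ℝ) : EReal :=
  ⨆ w ∈ {w : ℝ | {α : ℂ | IsAlgebraic ℚ α ∧ (minpoly ℚ α).natDegree ≤ n ∧
    ‖(ξ : ℂ) - α‖ ≤ algHeight α ^ (-w - 1)}.Infinite}, (w : EReal)

end

/-! # Approximation of extremal numbers by quadratic polynomials and quadratic numbers -/

/-! Write θ = 1/γ, so that θ² = 1 − θ. Each denominator n gives an integer point x = (n, y₁, y₂)
near n(1, ξ, ξ²), with error L(x). For the successive minimal points x_i, with denominators N_i,
extremality gives L(x_i) ≪ N_{i+1}^{-θ}. The rest of the growth analysis rests on non-zero integers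
being at least 1 in absolute value. Applied to the Hankel determinant of x_i, non-zero for large i
by `one_le_of_hankelDet_eq_zero`, this gives N_{i+1} ≪ N_i^γ; applied to three independent
consecutive points, it gives N_{i+1}^γ ≪ N_{i+2}. Between two independent triples the points stay in
one plane, and `rpow_next_le` bounds the growth there. The middle points b_k of the independent
triples (a_k, b_k, d_k) therefore satisfy b_{k+1} ≍ b_k^γ and L(b_k) ≪ 1/b_k, as recorded in
`IsExtremalSeq`.

Lower bound: a non-zero quadratic P of height H, read as a linear form, cannot vanish at all three
points of a triple. Once b_k^θ ≫ H, its integer value at a point of denominator n is nP(ξ) up to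
1/2, so |P(ξ)| ≫ 1/d_k; the least such k has d_k ≪ H^{γ³}.

Upper bound: the cross product of the points b_k and b_{k+1} is a quadratic P with H(P) ≪ t = b_k^θ,
|P(ξ)| ≪ t^{-γ³} and |P'(ξ)| ≫ t. The derivative bound yields a root within O(t^{-γ³-1}) of ξ
(`exists_root_near`), which carries the exponent over to w₂*. -/

variable {ξ : ℝ}

/-! ### The inverse of the golden ratio as an exponent -/

/-- The inverse of the golden ratio. -/
noncomputable def invGolden : ℝ := 1 / Real.goldenRatio

lemma invGolden_pos : 0 < invGolden := one_div_pos.2 Real.goldenRatio_pos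

lemma goldenRatio_eq : Real.goldenRatio = 1 + invGolden := by
  have h := Real.goldenRatio_sq
  have h1 : invGolden = Real.goldenRatio - 1 := by
    rw [invGolden, div_eq_iff Real.goldenRatio_ne_zero]
    linarith
  linarith

lemma invGolden_mul_goldenRatio : invGolden * Real.goldenRatio = 1 :=
  one_div_mul_cancel Real.goldenRatio_ne_zero

lemma invGolden_sq : invGolden * invGolden = 1 - invGolden := by
  have h := invGolden_mul_goldenRatio
  rw [goldenRatio_eq] at h
  linarith

lemma half_lt_invGolden : 1 / 2 < invGolden := by
  nlinarith [invGolden_sq, invGolden_pos]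

lemma le_rpow_goldenRatio_mul {x y A : ℝ} (hx : 0 ≤ x) (hy : 0 ≤ y) (hA : 0 ≤ A)
    (h : x ^ invGolden ≤ A * y ^ invGolden) : x ≤ A ^ Real.goldenRatio * y := by
  have h1 := Real.rpow_le_rpow (Real.rpow_nonneg hx _) h Real.goldenRatio_pos.le
  rwa [Real.mul_rpow hA (Real.rpow_nonneg hy _), ← Real.rpow_mul hx, ← Real.rpow_mul hy,
    invGolden_mul_goldenRatio, Real.rpow_one, Real.rpow_one] at h1

lemma le_rpow_goldenRatio {x y : ℝ} (hx : 0 ≤ x)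
    (h : x ^ invGolden ≤ y) : x ≤ y ^ Real.goldenRatio := by
  have h1 := Real.rpow_le_rpow (Real.rpow_nonneg hx _) h Real.goldenRatio_pos.le
  rwa [← Real.rpow_mul hx, invGolden_mul_goldenRatio, Real.rpow_one] at h1

/-- The relation 1 − θ = θ² for θ = 1/γ, written as two nested powers so that one of them can be
removed by raising to the power γ. -/
lemma mul_rpow_neg_invGolden {x : ℝ} (hx : 0 < x) :
    x * x ^ (-invGolden) = (x ^ invGolden) ^ invGolden := by
  rw [← Real.rpow_mul hx.le, invGolden_sq, Real.rpow_sub hx, Real.rpow_one,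
    Real.rpow_neg hx.le, div_eq_mul_inv]

/-! ### Simultaneous approximation to `ξ` and `ξ ^ 2` -/

/-- The integer closest to `n * ξ`. -/
noncomputable def nearOne (ξ : ℝ) (n : ℕ) : ℤ := round ((n : ℝ) * ξ)

/-- The integer closest to `n * ξ ^ 2`. -/
noncomputable def nearTwo (ξ : ℝ) (n : ℕ) : ℤ := round ((n : ℝ) * ξ ^ 2)

/-- The error of the best simultaneous approximation to `ξ` and `ξ ^ 2` with denominator `n`. -/
noncomputable def simErr (ξ : ℝ) (n : ℕ) : ℝ :=
  max |(n : ℝ) * ξ - nearOne ξ n| |(n : ℝ) * ξ ^ 2 - nearTwo ξ n|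

lemma abs_sub_nearOne_le (ξ : ℝ) (n : ℕ) : |(n : ℝ) * ξ - nearOne ξ n| ≤ simErr ξ n :=
  le_max_left _ _

lemma abs_sub_nearTwo_le (ξ : ℝ) (n : ℕ) : |(n : ℝ) * ξ ^ 2 - nearTwo ξ n| ≤ simErr ξ n :=
  le_max_right _ _

lemma simErr_nonneg (ξ : ℝ) (n : ℕ) : 0 ≤ simErr ξ n :=
  (abs_nonneg _).trans (abs_sub_nearOne_le ξ n)

lemma simErr_le_half (ξ : ℝ) (n : ℕ) : simErr ξ n ≤ 1 / 2 :=
  max_le (abs_sub_round _) (abs_sub_round _)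

lemma simErr_le_of_natAbs {c : ℝ} (x₀ x₁ x₂ : ℤ) (h₁ : |(x₀ : ℝ) * ξ - x₁| ≤ c)
    (h₂ : |(x₀ : ℝ) * ξ ^ 2 - x₂| ≤ c) : simErr ξ x₀.natAbs ≤ c := by
  have key : ∀ (x : ℝ) (y : ℤ), |(x₀ : ℝ) * x - y| ≤ c →
      |(x₀.natAbs : ℝ) * x - round ((x₀.natAbs : ℝ) * x)| ≤ c := by
    intro x y h
    rcases Int.natAbs_eq x₀ with h0 | h0
    · have : (x₀ : ℝ) = x₀.natAbs := by
        rw [← Int.cast_natCast]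
        exact congrArg Int.cast h0
      rw [this] at h
      exact (round_le _ _).trans h
    · have : (x₀ : ℝ) = -x₀.natAbs := by
        rw [← Int.cast_natCast, ← Int.cast_neg]
        exact congrArg Int.cast h0
      rw [this] at h
      refine (round_le _ (-y)).trans (le_trans (le_of_eq ?_) h)
      rw [← abs_neg]
      push_cast
      congr 1
      ring
  exact max_le (key ξ x₁ h₁) (key (ξ ^ 2) x₂ h₂)

/-- `ξ` is not a root of a non-zero integer polynomial of degree at most two. -/
def NotQuadratic (ξ : ℝ) : Prop :=
  ∀ a b c : ℤ, (a : ℝ) + b * ξ + c * ξ ^ 2 = 0 → a = 0 ∧ b = 0 ∧ c = 0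

lemma NotQuadratic.simErr_pos (h : NotQuadratic ξ) {n : ℕ} (hn : 1 ≤ n) : 0 < simErr ξ n := by
  refine lt_of_le_of_ne (simErr_nonneg ξ n) fun h0 => ?_
  have h1 : |(n : ℝ) * ξ - nearOne ξ n| = 0 :=
    le_antisymm (h0 ▸ abs_sub_nearOne_le ξ n) (abs_nonneg _)
  rw [abs_eq_zero] at h1
  have h2 := h (-nearOne ξ n) n 0 (by push_cast; linarith)
  omega

lemma exists_simErr_le {c : ℝ}
    (h : ∀ X : ℝ, 1 ≤ X →
      ∃ x₀ x₁ x₂ : ℤ, (x₀, x₁, x₂) ≠ (0, 0, 0) ∧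
        |(x₀ : ℝ)| ≤ X ∧
        |(x₀ : ℝ) * ξ - x₁| ≤ c * X ^ (-(1 / Real.goldenRatio)) ∧
        |(x₀ : ℝ) * ξ ^ 2 - x₂| ≤ c * X ^ (-(1 / Real.goldenRatio)))
    {X : ℝ} (hX : 1 ≤ X) :
    ∃ n : ℕ, 1 ≤ n ∧ (n : ℝ) ≤ X ∧ simErr ξ n ≤ c * X ^ (-invGolden) := by
  obtain ⟨x₀, x₁, x₂, hne, h0, h1, h2⟩ := h X hX
  -- If `x₀ = 0`, another coordinate is a non-zero integer, so the bound is at least 1 and `n = 1`,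
  -- with error at most 1/2, serves.
  by_cases hx : x₀ = 0
  · refine ⟨1, le_rfl, by simpa using hX, (simErr_le_half ξ 1).trans ?_⟩
    subst hx
    have hor : x₁ ≠ 0 ∨ x₂ ≠ 0 := by
      by_contra! hcon
      exact hne (by simp [hcon.1, hcon.2])
    simp only [Int.cast_zero, zero_mul, zero_sub, abs_neg] at h1 h2
    have : (1 : ℝ) ≤ c * X ^ (-invGolden) := by
      rcases hor with hor | hor
      · exact le_trans (by exact_mod_cast Int.one_le_abs hor) h1
      · exact le_trans (by exact_mod_cast Int.one_le_abs hor) h2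
    linarith
  · refine ⟨x₀.natAbs, Int.natAbs_pos.2 hx, ?_, simErr_le_of_natAbs x₀ x₁ x₂ h1 h2⟩
    rw [Nat.cast_natAbs, Int.cast_abs]
    exact h0

/-- A sequence of records of a function on the positive integers with infimum `0`. -/
lemma exists_strictMono_records (f : ℕ → ℝ) (hpos : ∀ n, 1 ≤ n → 0 < f n)
    (hsmall : ∀ ε > 0, ∃ n, 1 ≤ n ∧ f n < ε) :
    ∃ N : ℕ → ℕ, StrictMono N ∧ (∀ i, 1 ≤ N i) ∧ (∀ i, f (N (i + 1)) < f (N i)) ∧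
      ∀ i k, 1 ≤ k → k < N (i + 1) → f (N i) ≤ f k := by
  have hnext : ∀ n, 1 ≤ n → ∃ m, n < m ∧ f m < f n := by
    intro n hn
    have hne : (Finset.Icc 1 n).Nonempty := ⟨1, by simp [hn]⟩
    -- A value below the minimum over `[1, n]` is only taken beyond `n`.
    obtain ⟨k, hk, hmin⟩ := (Finset.Icc 1 n).exists_min_image f hne
    simp only [Finset.mem_Icc] at hk hmin
    obtain ⟨m, hm, hlt⟩ := hsmall (f k) (hpos k hk.1)
    refine ⟨m, ?_, hlt.trans_le (hmin n ⟨hn, le_rfl⟩)⟩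
    by_contra! hcon
    exact absurd (hmin m ⟨hm, hcon⟩) (not_le.2 hlt)
  classical
  choose! next hn1 hn2 hn3 using fun n (hn : 1 ≤ n) =>
    (⟨Nat.find (hnext n hn), (Nat.find_spec (hnext n hn)).1, (Nat.find_spec (hnext n hn)).2,
      fun k hk => Nat.find_min (hnext n hn) hk⟩ :
      ∃ m, n < m ∧ f m < f n ∧ ∀ k < m, ¬(n < k ∧ f k < f n))
  let N : ℕ → ℕ := fun i => next^[i] 1
  have hN : ∀ i, N (i + 1) = next (N i) := fun i => Function.iterate_succ_apply' _ _ _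
  have h1 : ∀ i, 1 ≤ N i := by
    intro i
    induction i with
    | zero => exact le_rfl
    | succ i ih => rw [hN]; exact ih.trans (hn1 _ ih).le
  refine ⟨N, strictMono_nat_of_lt_succ fun i => ?_, h1, fun i => ?_, fun i => ?_⟩
  · rw [hN]; exact hn1 _ (h1 i)
  · rw [hN]; exact hn2 _ (h1 i)
  · have hlast : ∀ i k, N i < k → k < N (i + 1) → f (N i) ≤ f k := by
      intro i k hk hk'
      rw [hN] at hk'
      by_contra! hcon
      exact hn3 _ (h1 i) k hk' ⟨hk, hcon⟩
    induction i with
    | zero =>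
      intro k hk hk'
      rcases hk.eq_or_lt with rfl | hlt
      · exact le_rfl
      · exact hlast 0 k hlt hk'
    | succ i ih =>
      intro k hk hk'
      rcases lt_trichotomy k (N (i + 1)) with hlt | rfl | hlt
      · refine le_trans ?_ (ih k hk hlt)
        rw [hN]
        exact (hn2 _ (h1 i)).le
      · exact le_rfl
      · exact hlast _ k hlt hk'

/-- `N` enumerates denominators of minimal points, with the uniform exponent of an extremal
number. -/
structure IsMinSeq (ξ c : ℝ) (N : ℕ → ℕ) : Prop where
  mono : StrictMono N
  one_le : ∀ i, 1 ≤ N i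
  err_lt : ∀ i, simErr ξ (N (i + 1)) < simErr ξ (N i)
  err_le : ∀ i, simErr ξ (N i) ≤ c * (N (i + 1) : ℝ) ^ (-invGolden)

lemma exists_isMinSeq (hq : NotQuadratic ξ) {c : ℝ} (hc : 0 < c)
    (h : ∀ X : ℝ, 1 ≤ X → ∃ n : ℕ, 1 ≤ n ∧ (n : ℝ) ≤ X ∧ simErr ξ n ≤ c * X ^ (-invGolden)) :
    ∃ N, IsMinSeq ξ (c * 2 ^ invGolden) N := by
  obtain ⟨N, hmono, h1, hlt, hrec⟩ := exists_strictMono_records (simErr ξ)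
    (fun n hn => hq.simErr_pos hn) (by
      intro ε hε
      have ht : Filter.Tendsto (fun X : ℝ => c * X ^ (-invGolden)) Filter.atTop (nhds 0) := by
        simpa using (tendsto_rpow_neg_atTop invGolden_pos).const_mul c
      obtain ⟨X, hX, hX1⟩ := ((ht.eventually_lt_const hε).and (Filter.eventually_ge_atTop 1)).exists
      obtain ⟨n, hn, -, hle⟩ := h X hX1
      exact ⟨n, hn, hle.trans_lt hX⟩)
  refine ⟨N, hmono, h1, hlt, fun i => ?_⟩
  have h2 : (2 : ℝ) ≤ N (i + 1) := by
    have := hmono (Nat.lt_add_one i)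
    have := h1 i
    exact_mod_cast (by omega : 2 ≤ N (i + 1))
  -- Half of `N (i + 1)` keeps `n` strictly below the next record, at the cost of the factor `2 ^
  -- invGolden`.
  obtain ⟨n, hn, hnX, hle⟩ := h ((N (i + 1) : ℝ) / 2) (by linarith)
  have hlt : n < N (i + 1) := by
    have : (n : ℝ) < N (i + 1) := by linarith
    exact_mod_cast this
  refine (hrec i n hn hlt).trans (hle.trans (le_of_eq ?_))
  rw [Real.div_rpow (by positivity) (by norm_num), Real.rpow_neg (by norm_num : (0 : ℝ) ≤ 2)]
  field_simp

/-! ### Cross products and determinants of approximation points -/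

/-- Coordinate `0` of the cross product of the points with denominators `n` and `m`. -/
noncomputable def wedgeZero (ξ : ℝ) (n m : ℕ) : ℤ :=
  nearOne ξ n * nearTwo ξ m - nearTwo ξ n * nearOne ξ m

/-- Coordinate `1` of the cross product of the points with denominators `n` and `m`. -/
noncomputable def wedgeOne (ξ : ℝ) (n m : ℕ) : ℤ := nearTwo ξ n * m - n * nearTwo ξ m

/-- Coordinate `2` of the cross product of the points with denominators `n` and `m`. -/
noncomputable def wedgeTwo (ξ : ℝ) (n m : ℕ) : ℤ := n * nearOne ξ m - nearOne ξ n * m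

/-- The value of the linear form with coefficients `u₀, u₁, u₂` at the point with
denominator `n`. -/
noncomputable def pairing (ξ : ℝ) (u₀ u₁ u₂ : ℤ) (n : ℕ) : ℤ :=
  u₀ * n + u₁ * nearOne ξ n + u₂ * nearTwo ξ n

/-- The determinant of three approximation points. -/
noncomputable def tripleDet (ξ : ℝ) (n m k : ℕ) : ℤ :=
  pairing ξ (wedgeZero ξ n m) (wedgeOne ξ n m) (wedgeTwo ξ n m) k

/-- The determinant of the symmetric matrix attached to an approximation point. -/
noncomputable def hankelDet (ξ : ℝ) (n : ℕ) : ℤ := n * nearTwo ξ n - nearOne ξ n ^ 2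

lemma abs_mul_sub_mul_le {n m a b A B : ℝ} (hn : 0 ≤ n) (hm : 0 ≤ m) (ha : |a| ≤ A)
    (hb : |b| ≤ B) : |n * b - m * a| ≤ n * B + m * A := by
  refine (abs_sub _ _).trans ?_
  rw [abs_mul, abs_mul, abs_of_nonneg hn, abs_of_nonneg hm]
  gcongr

lemma abs_wedgeOne_le (ξ : ℝ) (n m : ℕ) :
    |(wedgeOne ξ n m : ℝ)| ≤ n * simErr ξ m + m * simErr ξ n := by
  have h := abs_mul_sub_mul_le n.cast_nonneg m.cast_nonneg (abs_sub_nearTwo_le ξ n)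
    (abs_sub_nearTwo_le ξ m)
  refine le_trans (le_of_eq ?_) h
  congr 1
  rw [wedgeOne]
  push_cast
  ring

lemma abs_wedgeTwo_le (ξ : ℝ) (n m : ℕ) :
    |(wedgeTwo ξ n m : ℝ)| ≤ n * simErr ξ m + m * simErr ξ n := by
  have h := abs_mul_sub_mul_le n.cast_nonneg m.cast_nonneg (abs_sub_nearOne_le ξ n)
    (abs_sub_nearOne_le ξ m)
  rw [← abs_neg]
  refine le_trans (le_of_eq ?_) h
  congr 1
  rw [wedgeTwo]
  push_cast
  ring

lemma mul_simErr_add_le {n m : ℕ} (hnm : n ≤ m) (herr : simErr ξ m ≤ simErr ξ n) :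
    n * simErr ξ m + m * simErr ξ n ≤ 2 * (m * simErr ξ n) := by
  have h1 : (n : ℝ) ≤ m := by exact_mod_cast hnm
  have h2 : (n : ℝ) * simErr ξ m ≤ m * simErr ξ n :=
    mul_le_mul h1 herr (simErr_nonneg _ _) (by positivity)
  linarith

lemma abs_wedge_eval_le (ξ : ℝ) (n m : ℕ) :
    |(wedgeZero ξ n m : ℝ) + wedgeOne ξ n m * ξ + wedgeTwo ξ n m * ξ ^ 2| ≤
      2 * (simErr ξ n * simErr ξ m) := by
  have e : (wedgeZero ξ n m : ℝ) + wedgeOne ξ n m * ξ + wedgeTwo ξ n m * ξ ^ 2 =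
      ((n : ℝ) * ξ - nearOne ξ n) * ((m : ℝ) * ξ ^ 2 - nearTwo ξ m) -
      ((n : ℝ) * ξ ^ 2 - nearTwo ξ n) * ((m : ℝ) * ξ - nearOne ξ m) := by
    simp only [wedgeZero, wedgeOne, wedgeTwo]
    push_cast
    ring
  rw [e]
  refine (abs_sub _ _).trans ?_
  rw [abs_mul, abs_mul, two_mul]
  exact add_le_add
    (mul_le_mul (abs_sub_nearOne_le _ _) (abs_sub_nearTwo_le _ _) (abs_nonneg _)
      (simErr_nonneg _ _))
    (mul_le_mul (abs_sub_nearTwo_le _ _) (abs_sub_nearOne_le _ _) (abs_nonneg _)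
      (simErr_nonneg _ _))

/-- Proportional points have errors in the ratio of their denominators, whereas here the larger
denominator has the smaller error. -/
lemma wedge_ne_zero {n m : ℕ} (hnm : n < m) (herr : simErr ξ m < simErr ξ n)
    (h1 : wedgeOne ξ n m = 0) (h2 : wedgeTwo ξ n m = 0) : False := by
  have h1' : (nearTwo ξ n : ℝ) * m - n * nearTwo ξ m = 0 := by
    exact_mod_cast congrArg (Int.cast : ℤ → ℝ) h1
  have h2' : (n : ℝ) * nearOne ξ m - nearOne ξ n * m = 0 := by
    exact_mod_cast congrArg (Int.cast : ℤ → ℝ) h2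
  have e1 : (m : ℝ) * |(n : ℝ) * ξ - nearOne ξ n| = n * |(m : ℝ) * ξ - nearOne ξ m| := by
    rw [← Nat.abs_cast m, ← Nat.abs_cast n, ← abs_mul, ← abs_mul, Nat.abs_cast, Nat.abs_cast]
    congr 1
    linarith
  have e2 : (m : ℝ) * |(n : ℝ) * ξ ^ 2 - nearTwo ξ n| =
      n * |(m : ℝ) * ξ ^ 2 - nearTwo ξ m| := by
    rw [← Nat.abs_cast m, ← Nat.abs_cast n, ← abs_mul, ← abs_mul, Nat.abs_cast, Nat.abs_cast]
    congr 1
    linarith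
  have e : (m : ℝ) * simErr ξ n = n * simErr ξ m := by
    unfold simErr
    rw [mul_max_of_nonneg _ _ m.cast_nonneg, mul_max_of_nonneg _ _ n.cast_nonneg, e1, e2]
  have hlt : (n : ℝ) < m := by exact_mod_cast hnm
  have := simErr_nonneg ξ m
  nlinarith [n.cast_nonneg (α := ℝ)]

lemma pairing_eq (ξ : ℝ) (u₀ u₁ u₂ : ℤ) (n : ℕ) :
    (pairing ξ u₀ u₁ u₂ n : ℝ) = n * (u₀ + u₁ * ξ + u₂ * ξ ^ 2) -
      (u₁ * ((n : ℝ) * ξ - nearOne ξ n) + u₂ * ((n : ℝ) * ξ ^ 2 - nearTwo ξ n)) := by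
  rw [pairing]
  push_cast
  ring

lemma abs_pairing_sub_le (ξ : ℝ) (u₀ u₁ u₂ : ℤ) (n : ℕ) :
    |(pairing ξ u₀ u₁ u₂ n : ℝ) - n * (u₀ + u₁ * ξ + u₂ * ξ ^ 2)| ≤
      (|(u₁ : ℝ)| + |(u₂ : ℝ)|) * simErr ξ n := by
  rw [pairing_eq, sub_sub_cancel_left, abs_neg, add_mul]
  refine (abs_add_le _ _).trans ?_
  rw [abs_mul, abs_mul]
  gcongr
  · exact abs_sub_nearOne_le _ _
  · exact abs_sub_nearTwo_le _ _

/-- With u the cross product of the first two points, the determinant is k·u(ξ) up to (|u₁| +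
|u₂|)L(k). The first term contributes 2 to the constant; the second contributes 4, since |u₁| and
|u₂| are at most 2m·L(n). -/
lemma abs_tripleDet_le {n m k : ℕ} (hnm : n ≤ m) (hmk : m ≤ k)
    (h1 : simErr ξ m ≤ simErr ξ n) (h2 : simErr ξ k ≤ simErr ξ m) :
    |(tripleDet ξ n m k : ℝ)| ≤ 6 * (k * simErr ξ n * simErr ξ m) := by
  have hA := abs_pairing_sub_le ξ (wedgeZero ξ n m) (wedgeOne ξ n m) (wedgeTwo ξ n m) k
  have hB := abs_wedge_eval_le ξ n m
  have hC := (abs_wedgeOne_le ξ n m).trans (mul_simErr_add_le hnm h1)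
  have hD := (abs_wedgeTwo_le ξ n m).trans (mul_simErr_add_le hnm h1)
  set E : ℝ := (wedgeZero ξ n m : ℝ) + wedgeOne ξ n m * ξ + wedgeTwo ξ n m * ξ ^ 2
  have hmk' : (m : ℝ) ≤ k := by exact_mod_cast hmk
  have hn0 := simErr_nonneg ξ n
  have hm0 := simErr_nonneg ξ m
  have hk0 := simErr_nonneg ξ k
  have h3 : (|(wedgeOne ξ n m : ℝ)| + |(wedgeTwo ξ n m : ℝ)|) * simErr ξ k ≤
      4 * (k * simErr ξ n * simErr ξ m) := by
    calc _ ≤ (2 * (m * simErr ξ n) + 2 * (m * simErr ξ n)) * simErr ξ k := by gcongr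
      _ ≤ (2 * (k * simErr ξ n) + 2 * (k * simErr ξ n)) * simErr ξ m := by gcongr
      _ = _ := by ring
  have h4 : |(k : ℝ) * E| ≤ 2 * (k * simErr ξ n * simErr ξ m) := by
    rw [abs_mul, Nat.abs_cast]
    calc _ ≤ (k : ℝ) * (2 * (simErr ξ n * simErr ξ m)) := by gcongr
      _ = _ := by ring
  have h5 := abs_sub_abs_le_abs_sub (tripleDet ξ n m k : ℝ) (k * E)
  have h6 : |(tripleDet ξ n m k : ℝ) - k * E| ≤ _ := hA
  linarith

/-- Cramer's rule for three linear equations satisfied by the coefficients of a linear form. -/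
lemma pairing_eq_zero {u₀ u₁ u₂ : ℤ} {n m k : ℕ} (hdet : tripleDet ξ n m k ≠ 0)
    (hn : pairing ξ u₀ u₁ u₂ n = 0) (hm : pairing ξ u₀ u₁ u₂ m = 0)
    (hk : pairing ξ u₀ u₁ u₂ k = 0) : u₀ = 0 ∧ u₁ = 0 ∧ u₂ = 0 := by
  have key : ∀ u a b c : ℤ, tripleDet ξ n m k * u =
      a * pairing ξ u₀ u₁ u₂ n + b * pairing ξ u₀ u₁ u₂ m + c * pairing ξ u₀ u₁ u₂ k → u = 0 := by
    intro u a b c h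
    rw [hn, hm, hk] at h
    simpa [hdet] using h
  refine ⟨key _ (wedgeZero ξ m k) (wedgeZero ξ k n) (wedgeZero ξ n m) ?_,
    key _ (wedgeOne ξ m k) (wedgeOne ξ k n) (wedgeOne ξ n m) ?_,
    key _ (wedgeTwo ξ m k) (wedgeTwo ξ k n) (wedgeTwo ξ n m) ?_⟩ <;>
  · simp only [tripleDet, pairing, wedgeZero, wedgeOne, wedgeTwo]
    ring

/-- By Cramer's identities with two right-hand sides zero, a vanishing determinant would force the
cross product of the first two points to vanish in coordinates 1 and 2. -/
lemma tripleDet_ne_zero {u₀ u₁ u₂ : ℤ} {n m k : ℕ}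
    (hn : pairing ξ u₀ u₁ u₂ n = 0) (hm : pairing ξ u₀ u₁ u₂ m = 0)
    (hk : pairing ξ u₀ u₁ u₂ k ≠ 0) (hw : ¬(wedgeOne ξ n m = 0 ∧ wedgeTwo ξ n m = 0)) :
    tripleDet ξ n m k ≠ 0 := by
  intro hdet
  have e1 : tripleDet ξ n m k * u₁ = wedgeOne ξ m k * pairing ξ u₀ u₁ u₂ n +
      wedgeOne ξ k n * pairing ξ u₀ u₁ u₂ m + wedgeOne ξ n m * pairing ξ u₀ u₁ u₂ k := by
    simp only [tripleDet, pairing, wedgeZero, wedgeOne, wedgeTwo]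
    ring
  have e2 : tripleDet ξ n m k * u₂ = wedgeTwo ξ m k * pairing ξ u₀ u₁ u₂ n +
      wedgeTwo ξ k n * pairing ξ u₀ u₁ u₂ m + wedgeTwo ξ n m * pairing ξ u₀ u₁ u₂ k := by
    simp only [tripleDet, pairing, wedgeZero, wedgeOne, wedgeTwo]
    ring
  rw [hdet, hn, hm] at e1 e2
  simp only [zero_mul, mul_zero, zero_add, zero_eq_mul, hk, or_false] at e1 e2
  exact hw ⟨e1, e2⟩

/-- Coordinate 0 of u × (x_j × x_k) = (u·x_k)x_j − (u·x_j)x_k. The point where two planes meet is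
thus controlled by their normals. -/
lemma mul_pairing_eq {u₀ u₁ u₂ : ℤ} {j k : ℕ} (hj : pairing ξ u₀ u₁ u₂ j = 0) :
    (j : ℤ) * pairing ξ u₀ u₁ u₂ k = u₁ * wedgeTwo ξ j k - u₂ * wedgeOne ξ j k := by
  have : (j : ℤ) * pairing ξ u₀ u₁ u₂ k = u₁ * wedgeTwo ξ j k - u₂ * wedgeOne ξ j k +
      k * pairing ξ u₀ u₁ u₂ j := by
    simp only [pairing, wedgeOne, wedgeTwo]
    ring
  rw [this, hj, mul_zero, add_zero]

/-! ### The Hankel determinant and points on the conic x₀x₂ = x₁² -/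

lemma hankelDet_eq (ξ : ℝ) (n : ℕ) :
    (hankelDet ξ n : ℝ) = n * (2 * ξ * ((n : ℝ) * ξ - nearOne ξ n) -
      ((n : ℝ) * ξ ^ 2 - nearTwo ξ n)) - ((n : ℝ) * ξ - nearOne ξ n) ^ 2 := by
  rw [hankelDet]
  push_cast
  ring

lemma abs_two_mul_sub_le (ξ : ℝ) (n : ℕ) :
    |2 * ξ * ((n : ℝ) * ξ - nearOne ξ n) - ((n : ℝ) * ξ ^ 2 - nearTwo ξ n)| ≤
      (2 * |ξ| + 1) * simErr ξ n := by
  refine (abs_sub _ _).trans ?_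
  rw [abs_mul, abs_mul, abs_two, add_mul, one_mul]
  gcongr
  · exact abs_sub_nearOne_le _ _
  · exact abs_sub_nearTwo_le _ _

lemma abs_hankelDet_le {n : ℕ} (hn : 1 ≤ n) :
    |(hankelDet ξ n : ℝ)| ≤ (2 * |ξ| + 2) * (n * simErr ξ n) := by
  rw [hankelDet_eq]
  refine (abs_sub _ _).trans ?_
  have h1 := abs_two_mul_sub_le ξ n
  have h2 := abs_sub_nearOne_le ξ n
  have h3 := simErr_le_half ξ n
  have h0 := simErr_nonneg ξ n
  have hn' : (1 : ℝ) ≤ n := by exact_mod_cast hn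
  rw [abs_mul, Nat.abs_cast, abs_pow]
  calc _ ≤ (n : ℝ) * ((2 * |ξ| + 1) * simErr ξ n) + simErr ξ n ^ 2 := by gcongr
    _ ≤ _ := by nlinarith

lemma abs_nearOne_le (ξ : ℝ) {n : ℕ} (hn : 1 ≤ n) : |(nearOne ξ n : ℝ)| ≤ (|ξ| + 1) * n := by
  have h2 := abs_sub_nearOne_le ξ n
  have h3 := simErr_le_half ξ n
  have hn' : (1 : ℝ) ≤ n := by exact_mod_cast hn
  have h4 := abs_sub_abs_le_abs_sub (nearOne ξ n : ℝ) (n * ξ)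
  rw [abs_sub_comm, abs_mul, Nat.abs_cast] at h4
  linarith

lemma abs_mul_nearOne_sub_nearTwo_le (ξ : ℝ) (n : ℕ) :
    |(nearOne ξ n : ℝ) * ξ - nearTwo ξ n| ≤ (|ξ| + 1) * simErr ξ n := by
  have e : (nearOne ξ n : ℝ) * ξ - nearTwo ξ n =
      ((n : ℝ) * ξ ^ 2 - nearTwo ξ n) - ξ * ((n : ℝ) * ξ - nearOne ξ n) := by ring
  rw [e]
  refine (abs_sub _ _).trans ?_
  rw [abs_mul, add_mul, one_mul, add_comm]
  gcongr
  · exact abs_sub_nearOne_le _ _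
  · exact abs_sub_nearTwo_le _ _

/-- Dividing x and y by their gcd g leaves coprime p, q with pz = gq², so p divides g; the quotient
is the required factor. -/
lemma exists_square_factor {x y z : ℤ} (hx : x ≠ 0) (h : x * z = y ^ 2) :
    ∃ g p q : ℤ, x = g * p ^ 2 ∧ y = g * (p * q) ∧ z = g * q ^ 2 := by
  obtain ⟨p, q, hpq, hp, hq⟩ := Int.exists_gcd_one (m := x) (n := y)
    (Int.gcd_pos_of_ne_zero_left _ hx)
  set g : ℤ := (Int.gcd x y : ℤ)
  have hg : g ≠ 0 := by
    rintro h0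
    rw [h0, mul_zero] at hp
    exact hx hp
  have hp0 : p ≠ 0 := by
    rintro rfl
    rw [zero_mul] at hp
    exact hx hp
  have e : p * z = g * q ^ 2 := by
    apply mul_left_cancel₀ hg
    rw [hp, hq] at h
    linarith
  have hdvd : p ∣ g := by
    have : IsCoprime p (q ^ 2) := (Int.isCoprime_iff_gcd_eq_one.2 hpq).pow_right
    exact this.dvd_of_dvd_mul_right ⟨z, e.symm⟩
  obtain ⟨m, hm⟩ := hdvd
  refine ⟨m, p, q, by rw [hp, hm]; ring, by rw [hq, hm]; ring, ?_⟩
  apply mul_left_cancel₀ hp0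
  rw [e, hm]
  ring

/-- If the point with denominator `m` lies on the conic `x₀ x₂ = x₁ ^ 2`, then any other point
with smaller denominator has a large approximation error. -/
lemma one_le_of_hankelDet_eq_zero {n m : ℕ} (hn : 1 ≤ n) (hnm : n < m)
    (herr : simErr ξ m < simErr ξ n) (hdet : hankelDet ξ m = 0) :
    1 ≤ 4 * (|ξ| + 1) ^ 2 * (m * simErr ξ n ^ 2) := by
  have hm0 : (m : ℤ) ≠ 0 := by omega
  obtain ⟨g, p, q, h0, h1, h2⟩ := exists_square_factor hm0 (sub_eq_zero.1 hdet)
  have hg0 : g ≠ 0 := by rintro rfl; simp at h0; omega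
  have hp0 : p ≠ 0 := by rintro rfl; simp at h0; omega
  have hgpos : 1 ≤ g := by
    have : 0 < g * p ^ 2 := by rw [← h0]; omega
    have := pos_of_mul_pos_left this (sq_nonneg p)
    omega
  have hgR : (1 : ℝ) ≤ g := by exact_mod_cast hgpos
  have h0' : (m : ℝ) = g * p ^ 2 := by exact_mod_cast congrArg (Int.cast : ℤ → ℝ) h0
  have h1' : (nearOne ξ m : ℝ) = g * (p * q) := by
    exact_mod_cast congrArg (Int.cast : ℤ → ℝ) h1
  have hpp : 0 < |(p : ℝ)| := by positivity
  -- For x_m = g(p², pq, q²) this reads g|p||pξ − q| ≤ L(m): a good approximation q/p to ξ with p² ≤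
  -- m.
  have hL := abs_sub_nearOne_le ξ m
  rw [h0', h1', show (g : ℝ) * p ^ 2 * ξ - g * (p * q) = g * (p * (p * ξ - q)) by ring, abs_mul,
    abs_mul, abs_of_pos (by linarith : (0 : ℝ) < g)] at hL
  have hn' : (0 : ℝ) < n := by exact_mod_cast hn
  have hnm' : (n : ℝ) ≤ g * |(p : ℝ)| ^ 2 := by
    rw [sq_abs, ← h0']
    exact_mod_cast hnm.le
  have hnL : (n : ℝ) * |(p : ℝ) * ξ - q| ≤ |(p : ℝ)| * simErr ξ n := by
    calc (n : ℝ) * |(p : ℝ) * ξ - q| ≤ (g * |(p : ℝ)| ^ 2) * |(p : ℝ) * ξ - q| := by gcongr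
      _ = |(p : ℝ)| * (g * (|(p : ℝ)| * |(p : ℝ) * ξ - q|)) := by ring
      _ ≤ |(p : ℝ)| * simErr ξ n := by gcongr; linarith
  have hb1 : |((n * q - nearOne ξ n * p : ℤ) : ℝ)| ≤
      2 * (|ξ| + 1) * (|(p : ℝ)| * simErr ξ n) := by
    have e : ((n * q - nearOne ξ n * p : ℤ) : ℝ) =
        p * ((n : ℝ) * ξ - nearOne ξ n) - n * ((p : ℝ) * ξ - q) := by
      push_cast; ring
    rw [e]
    refine (abs_sub _ _).trans ?_
    rw [abs_mul, abs_mul, Nat.abs_cast]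
    have := mul_le_mul_of_nonneg_left (abs_sub_nearOne_le ξ n) hpp.le
    nlinarith [mul_nonneg (abs_nonneg ξ) (mul_nonneg hpp.le (simErr_nonneg ξ n))]
  have hb2 : |((nearOne ξ n * q - nearTwo ξ n * p : ℤ) : ℝ)| ≤
      2 * (|ξ| + 1) * (|(p : ℝ)| * simErr ξ n) := by
    have e : ((nearOne ξ n * q - nearTwo ξ n * p : ℤ) : ℝ) =
        p * ((nearOne ξ n : ℝ) * ξ - nearTwo ξ n) - nearOne ξ n * ((p : ℝ) * ξ - q) := by
      push_cast; ring
    rw [e]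
    refine (abs_sub _ _).trans ?_
    rw [abs_mul, abs_mul]
    have t1 := mul_le_mul_of_nonneg_left (abs_mul_nearOne_sub_nearTwo_le ξ n) hpp.le
    have t2 : |(nearOne ξ n : ℝ)| * |(p : ℝ) * ξ - q| ≤
        (|ξ| + 1) * (|(p : ℝ)| * simErr ξ n) := by
      calc _ ≤ ((|ξ| + 1) * n) * |(p : ℝ) * ξ - q| := by gcongr; exact abs_nearOne_le ξ hn
        _ = (|ξ| + 1) * (n * |(p : ℝ) * ξ - q|) := by ring
        _ ≤ _ := by gcongr
    linarith
  -- The two integers just bounded cannot both vanish: x_n would then be proportional to (p², pq,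
  -- q²), hence to x_m.
  have hge : 1 ≤ 2 * (|ξ| + 1) * (|(p : ℝ)| * simErr ξ n) := by
    by_contra! hlt
    have z1 : (n * q - nearOne ξ n * p : ℤ) = 0 := by
      have : |((n * q - nearOne ξ n * p : ℤ) : ℝ)| < 1 := hb1.trans_lt hlt
      exact Int.abs_lt_one_iff.1 (by exact_mod_cast this)
    have z2 : (nearOne ξ n * q - nearTwo ξ n * p : ℤ) = 0 := by
      have : |((nearOne ξ n * q - nearTwo ξ n * p : ℤ) : ℝ)| < 1 := hb2.trans_lt hlt
      exact Int.abs_lt_one_iff.1 (by exact_mod_cast this)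
    refine wedge_ne_zero hnm herr ?_ ?_
    · rw [wedgeOne, h0, h2]
      linear_combination (-g * q) * z1 - g * p * z2
    · rw [wedgeTwo, h0, h1]
      linear_combination (g * p) * z1
  have hsq : 1 ≤ (2 * (|ξ| + 1) * (|(p : ℝ)| * simErr ξ n)) ^ 2 := one_le_pow₀ hge
  refine hsq.trans ?_
  rw [mul_pow, mul_pow, mul_pow, sq_abs, h0']
  have : (p : ℝ) ^ 2 * simErr ξ n ^ 2 ≤ g * p ^ 2 * simErr ξ n ^ 2 := by
    gcongr
    nlinarith [sq_nonneg (p : ℝ)]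
  nlinarith [sq_nonneg (|ξ| + 1)]

/-! ### Growth of the sequence of minimal points -/

namespace IsMinSeq

variable {c : ℝ} {N : ℕ → ℕ}

lemma strictAnti (h : IsMinSeq ξ c N) : StrictAnti fun i => simErr ξ (N i) :=
  strictAnti_nat_of_succ_lt h.err_lt

lemma cast_pos (h : IsMinSeq ξ c N) (i : ℕ) : (0 : ℝ) < N i := by
  exact_mod_cast h.one_le i

lemma tendsto (h : IsMinSeq ξ c N) :
    Filter.Tendsto (fun i => (N i : ℝ)) Filter.atTop Filter.atTop :=
  tendsto_natCast_atTop_atTop.comp h.mono.tendsto_atTop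

lemma const_pos (h : IsMinSeq ξ c N) (hq : NotQuadratic ξ) : 0 < c := by
  have h1 := (hq.simErr_pos (h.one_le 0)).trans_le (h.err_le 0)
  exact pos_of_mul_pos_left h1 (Real.rpow_nonneg (h.cast_pos 1).le _)

lemma mul_simErr_le (h : IsMinSeq ξ c N) (i : ℕ) :
    N (i + 1) * simErr ξ (N i) ≤ c * ((N (i + 1) : ℝ) ^ invGolden) ^ invGolden := by
  rw [← mul_rpow_neg_invGolden (h.cast_pos _), mul_left_comm]
  exact mul_le_mul_of_nonneg_left (h.err_le i) (h.cast_pos _).le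

/-- A zero at N_{i+1} would need N_{i+1}L_i² ≫ 1, but this quantity is ≪ N_{i+1}^{1-2θ}, which tends
to 0 because θ > 1/2. -/
lemma eventually_hankelDet_ne_zero (h : IsMinSeq ξ c N) :
    ∃ i₀, ∀ i, i₀ ≤ i → hankelDet ξ (N (i + 1)) ≠ 0 := by
  have ht : Filter.Tendsto
      (fun i => 4 * (|ξ| + 1) ^ 2 * c ^ 2 * (N (i + 1) : ℝ) ^ (-(2 * invGolden - 1)))
      Filter.atTop (nhds 0) := by
    have h1 : Filter.Tendsto (fun i => (N (i + 1) : ℝ)) Filter.atTop Filter.atTop :=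
      (Filter.tendsto_add_atTop_iff_nat 1).2 h.tendsto
    have hpos : 0 < 2 * invGolden - 1 := by linarith [half_lt_invGolden]
    simpa using ((tendsto_rpow_neg_atTop hpos).comp h1).const_mul (4 * (|ξ| + 1) ^ 2 * c ^ 2)
  obtain ⟨i₀, hi₀⟩ := Filter.eventually_atTop.1 (ht.eventually_lt_const one_pos)
  refine ⟨i₀, fun i hi hdet => ?_⟩
  have h1 := one_le_of_hankelDet_eq_zero (h.one_le i) (h.mono (Nat.lt_add_one i)) (h.err_lt i) hdet
  have h2 := hi₀ i hi
  have hm := h.cast_pos (i + 1)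
  have h3 : (N (i + 1) : ℝ) * simErr ξ (N i) ^ 2 ≤
      c ^ 2 * (N (i + 1) : ℝ) ^ (-(2 * invGolden - 1)) := by
    calc (N (i + 1) : ℝ) * simErr ξ (N i) ^ 2
        ≤ N (i + 1) * (c * (N (i + 1) : ℝ) ^ (-invGolden)) ^ 2 := by
          gcongr
          · exact simErr_nonneg _ _
          · exact h.err_le i
      _ = c ^ 2 * (N (i + 1) * ((N (i + 1) : ℝ) ^ (-invGolden)) ^ (2 : ℕ)) := by ring
      _ = _ := by
          rw [← Real.rpow_mul_natCast hm.le]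
          nth_rewrite 1 [← Real.rpow_one (N (i + 1) : ℝ)]
          rw [← Real.rpow_add hm]
          congr 2
          push_cast
          ring
  have h4 := mul_le_mul_of_nonneg_left h3 (by positivity : 0 ≤ 4 * (|ξ| + 1) ^ 2)
  linarith

/-- The non-zero integer `hankelDet` is ≪ N_i L_i ≪ N_i N_{i+1}^{-θ}. -/
lemma rpow_succ_le (h : IsMinSeq ξ c N) {i : ℕ} (hdet : hankelDet ξ (N i) ≠ 0) :
    (N (i + 1) : ℝ) ^ invGolden ≤ (2 * |ξ| + 2) * c * N i := by
  have h1 : (1 : ℝ) ≤ |(hankelDet ξ (N i) : ℝ)| := by exact_mod_cast Int.one_le_abs hdet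
  have h2 := h1.trans (abs_hankelDet_le (h.one_le i))
  have hm := h.cast_pos (i + 1)
  have hp := Real.rpow_pos_of_pos hm invGolden
  have h3 : 1 ≤ (2 * |ξ| + 2) * (N i * (c * (N (i + 1) : ℝ) ^ (-invGolden))) := by
    refine h2.trans ?_
    gcongr
    exact h.err_le i
  rw [Real.rpow_neg hm.le] at h3
  have h4 := mul_le_mul_of_nonneg_left h3 hp.le
  have e : (N (i + 1) : ℝ) ^ invGolden *
      ((2 * |ξ| + 2) * (N i * (c * ((N (i + 1) : ℝ) ^ invGolden)⁻¹))) =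
      (2 * |ξ| + 2) * c * N i := by
    field_simp
  linarith

/-- From 1 ≤ 6N_{i+2}L_iL_{i+1} ≪ N_{i+1}^{-θ}(N_{i+2}^θ)^θ, raised to the power γ. -/
lemma le_mul_rpow_succ (h : IsMinSeq ξ c N) {i : ℕ}
    (hdet : tripleDet ξ (N i) (N (i + 1)) (N (i + 2)) ≠ 0) :
    (N (i + 1) : ℝ) ≤ (6 * c ^ 2) ^ Real.goldenRatio * (N (i + 2) : ℝ) ^ invGolden := by
  have h1 : (1 : ℝ) ≤ |(tripleDet ξ (N i) (N (i + 1)) (N (i + 2)) : ℝ)| := by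
    exact_mod_cast Int.one_le_abs hdet
  have h2 := h1.trans (abs_tripleDet_le (h.mono.monotone (Nat.le_succ i))
    (h.mono.monotone (Nat.le_succ (i + 1))) (h.err_lt i).le (h.err_lt (i + 1)).le)
  have hm := h.cast_pos (i + 1)
  have hk := h.cast_pos (i + 2)
  have hc : 0 ≤ c := by
    have := (simErr_nonneg ξ (N i)).trans (h.err_le i)
    exact nonneg_of_mul_nonneg_left this (Real.rpow_pos_of_pos hm _)
  apply le_rpow_goldenRatio_mul hm.le (by positivity) (by positivity)
  have hp := Real.rpow_pos_of_pos hm invGolden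
  have h3 : 1 ≤ 6 * ((c * (N (i + 1) : ℝ) ^ (-invGolden)) *
      (c * ((N (i + 2) : ℝ) ^ invGolden) ^ invGolden)) := by
    refine h2.trans ?_
    have := mul_le_mul (h.err_le i) (h.mul_simErr_le (i + 1))
      (mul_nonneg hk.le (simErr_nonneg _ _)) (by positivity)
    nlinarith
  rw [Real.rpow_neg hm.le] at h3
  have h4 := mul_le_mul_of_nonneg_left h3 hp.le
  have e : (N (i + 1) : ℝ) ^ invGolden * (6 * ((c * ((N (i + 1) : ℝ) ^ invGolden)⁻¹) *
      (c * ((N (i + 2) : ℝ) ^ invGolden) ^ invGolden))) =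
      6 * c ^ 2 * ((N (i + 2) : ℝ) ^ invGolden) ^ invGolden := by
    field_simp
  linarith

/-- From every minimal point one reaches a later one at which three consecutive minimal points are
linearly independent, all intermediate points staying in a plane. -/
lemma exists_next (h : IsMinSeq ξ c N) (hq : NotQuadratic ξ) (i : ℕ) :
    ∃ j, i ≤ j ∧ tripleDet ξ (N j) (N (j + 1)) (N (j + 2)) ≠ 0 ∧
      pairing ξ (wedgeZero ξ (N i) (N (i + 1))) (wedgeOne ξ (N i) (N (i + 1)))
        (wedgeTwo ξ (N i) (N (i + 1))) (N (j + 1)) = 0 ∧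
      pairing ξ (wedgeZero ξ (N i) (N (i + 1))) (wedgeOne ξ (N i) (N (i + 1)))
        (wedgeTwo ξ (N i) (N (i + 1))) (N (j + 2)) ≠ 0 := by
  set u₀ := wedgeZero ξ (N i) (N (i + 1)) with hu₀
  set u₁ := wedgeOne ξ (N i) (N (i + 1)) with hu₁
  set u₂ := wedgeTwo ξ (N i) (N (i + 1)) with hu₂
  have hw : ∀ j, ¬(wedgeOne ξ (N j) (N (j + 1)) = 0 ∧ wedgeTwo ξ (N j) (N (j + 1)) = 0) :=
    fun j hj => wedge_ne_zero (h.mono (Nat.lt_add_one j)) (h.err_lt j) hj.1 hj.2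
  have hz0 : pairing ξ u₀ u₁ u₂ (N i) = 0 := by
    simp only [hu₀, hu₁, hu₂, pairing, wedgeZero, wedgeOne, wedgeTwo]
    ring
  have hz1 : pairing ξ u₀ u₁ u₂ (N (i + 1)) = 0 := by
    simp only [hu₀, hu₁, hu₂, pairing, wedgeZero, wedgeOne, wedgeTwo]
    ring
  -- If the form vanished at all later points, N_n·u(ξ) would stay bounded, so u(ξ) = 0, contrary to
  -- `NotQuadratic`.
  have hex : ∃ n, i ≤ n ∧ pairing ξ u₀ u₁ u₂ (N n) ≠ 0 := by
    by_contra! hcon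
    have hev : (u₀ : ℝ) + u₁ * ξ + u₂ * ξ ^ 2 = 0 := by
      by_contra hne
      have hpos := abs_pos.2 hne
      obtain ⟨n, hn, hin⟩ := ((h.tendsto.eventually_gt_atTop
        ((|(u₁ : ℝ)| + |(u₂ : ℝ)|) / |(u₀ : ℝ) + u₁ * ξ + u₂ * ξ ^ 2|)).and
        (Filter.eventually_ge_atTop i)).exists
      have hb := abs_pairing_sub_le ξ u₀ u₁ u₂ (N n)
      rw [hcon n hin, Int.cast_zero, zero_sub, abs_neg, abs_mul, Nat.abs_cast] at hb
      rw [div_lt_iff₀ hpos] at hn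
      have h1 := simErr_le_half ξ (N n)
      have h2 := simErr_nonneg ξ (N n)
      nlinarith [abs_nonneg (u₁ : ℝ), abs_nonneg (u₂ : ℝ)]
    have := hq _ _ _ hev
    exact hw i this.2
  classical
  obtain ⟨hn1, hn2⟩ := Nat.find_spec hex
  have hmin : ∀ m, i ≤ m → m < Nat.find hex → pairing ξ u₀ u₁ u₂ (N m) = 0 := by
    intro m him hm
    by_contra hne
    exact Nat.find_min hex hm ⟨him, hne⟩
  generalize Nat.find hex = n at hn1 hn2 hmin
  have hni : n ≠ i := by rintro rfl; exact hn2 hz0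
  have hni' : n ≠ i + 1 := by rintro rfl; exact hn2 hz1
  -- The first point off the plane has index at least `i + 2`, so its two predecessors lie in the
  -- plane.
  obtain ⟨j, rfl⟩ : ∃ j, n = j + 2 := ⟨n - 2, by omega⟩
  have hA := hmin j (by omega) (by omega)
  have hB := hmin (j + 1) (by omega) (by omega)
  exact ⟨j, by omega, tripleDet_ne_zero hA hB hn2 (hw j), hB, hn2⟩

/-- The planes of (x_i, x_{i+1}) and (x_j, x_{j+1}) meet in the line of x_j, so N_j is at most a
constant times the product of the sizes of their normals. A normal has size ≪ N_{l+1}L_l ≪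
(N_{l+1}^θ)^θ ≪ N_l^θ. Hence N_j ≪ N_i^θ N_j^θ, and 1 − θ = θ² concludes. -/
lemma rpow_next_le (h : IsMinSeq ξ c N) (hq : NotQuadratic ξ) {i j : ℕ}
    (hi : hankelDet ξ (N i) ≠ 0) (hj : hankelDet ξ (N j) ≠ 0)
    (h0 : pairing ξ (wedgeZero ξ (N i) (N (i + 1))) (wedgeOne ξ (N i) (N (i + 1)))
        (wedgeTwo ξ (N i) (N (i + 1))) (N j) = 0)
    (h1 : pairing ξ (wedgeZero ξ (N i) (N (i + 1))) (wedgeOne ξ (N i) (N (i + 1)))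
        (wedgeTwo ξ (N i) (N (i + 1))) (N (j + 1)) ≠ 0) :
    (N j : ℝ) ^ invGolden ≤ (8 * c ^ 2 * (((2 * |ξ| + 2) * c) ^ invGolden) ^ 2) ^
      Real.goldenRatio * N i := by
  have hc := h.const_pos hq
  have key : ∀ l, hankelDet ξ (N l) ≠ 0 →
      N (l + 1) * simErr ξ (N l) ≤ c * ((2 * |ξ| + 2) * c) ^ invGolden * (N l : ℝ) ^ invGolden := by
    intro l hl
    have hlp := h.cast_pos (l + 1)
    refine (h.mul_simErr_le l).trans ?_
    rw [mul_assoc, ← Real.mul_rpow (by positivity) (by positivity)]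
    gcongr
    · exact invGolden_pos.le
    · exact h.rpow_succ_le hl
  have hu : ∀ l, N l * simErr ξ (N (l + 1)) + N (l + 1) * simErr ξ (N l) ≤
      2 * (N (l + 1) * simErr ξ (N l)) := fun l =>
    mul_simErr_add_le (h.mono.monotone (Nat.le_succ l)) (h.err_lt l).le
  have hu1 := (abs_wedgeOne_le ξ (N i) (N (i + 1))).trans (hu i)
  have hu2 := (abs_wedgeTwo_le ξ (N i) (N (i + 1))).trans (hu i)
  have hv1 := (abs_wedgeOne_le ξ (N j) (N (j + 1))).trans (hu j)
  have hv2 := (abs_wedgeTwo_le ξ (N j) (N (j + 1))).trans (hu j)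
  have hmul := congrArg (fun z : ℤ => |(z : ℝ)|) (mul_pairing_eq h0 (k := N (j + 1)))
  have hone : (1 : ℝ) ≤ |(pairing ξ (wedgeZero ξ (N i) (N (i + 1))) (wedgeOne ξ (N i) (N (i + 1)))
        (wedgeTwo ξ (N i) (N (i + 1))) (N (j + 1)) : ℝ)| := by
    exact_mod_cast Int.one_le_abs h1
  rw [Int.cast_mul, Int.cast_natCast, abs_mul, Nat.abs_cast, Int.cast_sub, Int.cast_mul,
    Int.cast_mul] at hmul
  have hle : (N j : ℝ) ≤ 8 * ((N (i + 1) * simErr ξ (N i)) * (N (j + 1) * simErr ξ (N j))) := by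
    have h5 := le_mul_of_one_le_right (h.cast_pos j).le hone
    rw [hmul] at h5
    have h6 := h5.trans (abs_sub _ _)
    rw [abs_mul, abs_mul] at h6
    have h7 := mul_le_mul hu1 hv2 (abs_nonneg _) ((abs_nonneg _).trans hu1)
    have h8 := mul_le_mul hu2 hv1 (abs_nonneg _) ((abs_nonneg _).trans hu2)
    linarith
  have hjp := h.cast_pos j
  have hip := h.cast_pos i
  have hle2 : (N j : ℝ) ≤ 8 * c ^ 2 * (((2 * |ξ| + 2) * c) ^ invGolden) ^ 2 *
      (N i : ℝ) ^ invGolden * (N j : ℝ) ^ invGolden := by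
    refine hle.trans ?_
    have := mul_le_mul (key i hi) (key j hj)
      (mul_nonneg (h.cast_pos _).le (simErr_nonneg _ _)) (by positivity)
    nlinarith
  apply le_rpow_goldenRatio_mul (by positivity) hip.le (by positivity)
  rw [← mul_rpow_neg_invGolden hjp, Real.rpow_neg hjp.le, ← div_eq_mul_inv,
    div_le_iff₀ (by positivity)]
  exact hle2

end IsMinSeq

/-- A sequence of triples of approximation points attached to an extremal number. The middle points
`b k` grow like `b (k + 1) ≍ b k ^ γ`, and their errors are `≪ 1 / b k`. -/
structure IsExtremalSeq (ξ C : ℝ) (a b d : ℕ → ℕ) : Prop where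
  mono : StrictMono b
  one_le : ∀ k, 1 ≤ b k
  lt_left : ∀ k, a k < b k
  lt_right : ∀ k, b k < d k
  tripleDet_ne : ∀ k, tripleDet ξ (a k) (b k) (d k) ≠ 0
  hankelDet_ne : ∀ k, hankelDet ξ (b k) ≠ 0
  err_left : ∀ k, simErr ξ (a k) ≤ C * (b k : ℝ) ^ (-invGolden)
  err_mid_lt : ∀ k, simErr ξ (b k) < simErr ξ (a k)
  err_right_lt : ∀ k, simErr ξ (d k) < simErr ξ (b k)
  err_succ_lt : ∀ k, simErr ξ (b (k + 1)) < simErr ξ (b k)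
  err_mid : ∀ k, b k * simErr ξ (b k) ≤ C
  right_le : ∀ k, (d k : ℝ) ^ invGolden ≤ C * b k
  succ_le : ∀ k, (b (k + 1) : ℝ) ^ invGolden ≤ C * b k
  le_succ : ∀ k, (b k : ℝ) ≤ C * (b (k + 1) : ℝ) ^ invGolden

lemma IsMinSeq.exists_isExtremalSeq {c : ℝ} {N : ℕ → ℕ} (h : IsMinSeq ξ c N)
    (hq : NotQuadratic ξ) : ∃ (C : ℝ) (a b d : ℕ → ℕ), 0 < C ∧ IsExtremalSeq ξ C a b d := by
  have hc := h.const_pos hq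
  obtain ⟨i₀, hi₀⟩ := h.eventually_hankelDet_ne_zero
  choose next hle hdet hz hnz using h.exists_next hq
  -- Restarting from `J k + 1` makes the plane spanned by `N (J k + 1)` and `N (J k + 2)` contain
  -- the next middle point `N (J (k + 1) + 1)`.
  let J : ℕ → ℕ := fun k => (fun j => next (j + 1))^[k] (next i₀)
  have hJ : ∀ k, J (k + 1) = next (J k + 1) := fun k => Function.iterate_succ_apply' _ _ _
  have hJlt : ∀ k, J k < J (k + 1) := fun k => by
    rw [hJ]
    exact (Nat.lt_add_one _).trans_le (hle _)
  have hJmono : StrictMono J := strictMono_nat_of_lt_succ hJlt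
  have hJ0 : ∀ k, i₀ ≤ J k := fun k => (hle i₀).trans (hJmono.monotone (Nat.zero_le k))
  have hJdet : ∀ k, tripleDet ξ (N (J k)) (N (J k + 1)) (N (J k + 2)) ≠ 0 := by
    intro k
    cases k with
    | zero => exact hdet i₀
    | succ k => rw [hJ]; exact hdet _
  have hH : ∀ k, hankelDet ξ (N (J k + 1)) ≠ 0 := fun k => hi₀ _ (hJ0 k)
  set C₁ := (2 * |ξ| + 2) * c
  set C₂ := (6 * c ^ 2) ^ Real.goldenRatio
  set C₃ := (8 * c ^ 2 * (C₁ ^ invGolden) ^ 2) ^ Real.goldenRatio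
  have hC₁ : 0 < C₁ := by positivity
  have hC₂ : 0 < C₂ := by positivity
  have hC₃ : 0 < C₃ := by positivity
  have hcC₂ : 0 < c * C₂ := by positivity
  have bump : ∀ {x y z w : ℝ}, 0 ≤ w → x ≤ y * w → y ≤ z → x ≤ z * w :=
    fun hw h1 h2 => h1.trans (mul_le_mul_of_nonneg_right h2 hw)
  refine ⟨c + C₁ + C₂ + C₃ + c * C₂, fun k => N (J k), fun k => N (J k + 1), fun k => N (J k + 2),
    by positivity, ?_, ?_, ?_, ?_, ?_, ?_, ?_, ?_, ?_, ?_, ?_, ?_, ?_, ?_⟩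
  · exact fun k l hkl => h.mono (Nat.add_lt_add_right (hJmono hkl) 1)
  · exact fun k => h.one_le _
  · exact fun k => h.mono (Nat.lt_add_one _)
  · exact fun k => h.mono (Nat.lt_add_one _)
  · exact hJdet
  · exact hH
  · exact fun k => bump (Real.rpow_nonneg (h.cast_pos _).le _) (h.err_le (J k)) (by linarith)
  · exact fun k => h.err_lt _
  · exact fun k => h.err_lt _
  · exact fun k => h.strictAnti (Nat.add_lt_add_right (hJlt k) 1)
  · intro k
    -- Independence gives b_k ≪ d_k^θ while L(b_k) ≪ d_k^{-θ}; the powers cancel.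
    have h1 := h.le_mul_rpow_succ (hJdet k)
    have hp := Real.rpow_pos_of_pos (h.cast_pos (J k + 2)) invGolden
    have h2 := mul_le_mul h1 (h.err_le (J k + 1)) (simErr_nonneg _ _) (by positivity)
    rw [Real.rpow_neg (h.cast_pos _).le] at h2
    have e : C₂ * (N (J k + 2) : ℝ) ^ invGolden *
        (c * ((N (J k + 1 + 1) : ℝ) ^ invGolden)⁻¹) = c * C₂ := by
      have : (N (J k + 2) : ℝ) ^ invGolden ≠ 0 := hp.ne'
      field_simp
    linarith
  · exact fun k => bump (h.cast_pos _).le (h.rpow_succ_le (hH k)) (by linarith)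
  · intro k
    have hA : hankelDet ξ (N (J (k + 1) + 1)) ≠ 0 := hH (k + 1)
    have hB := hz (J k + 1)
    have hC := hnz (J k + 1)
    rw [← hJ] at hB hC
    exact bump (h.cast_pos _).le (h.rpow_next_le hq (hH k) hA hB hC) (by linarith)
  · intro k
    refine bump (Real.rpow_nonneg (h.cast_pos _).le _) ((h.le_mul_rpow_succ (hJdet k)).trans
      (mul_le_mul_of_nonneg_left ?_ hC₂.le)) (by linarith : C₂ ≤ _)
    apply Real.rpow_le_rpow (h.cast_pos _).le _ invGolden_pos.le
    exact_mod_cast h.mono.monotone (by have := hJlt k; omega)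

/-! ### Integer polynomials of degree at most two -/

lemma eq_quadratic {R : Type*} [CommRing R] {P : R[X]} (hP : P.natDegree ≤ 2) :
    P = C (P.coeff 2) * X ^ 2 + C (P.coeff 1) * X + C (P.coeff 0) := by
  ext n
  rcases n with _ | _ | _ | n
  · simp
  · simp [coeff_C]
  · simp
  · rw [coeff_eq_zero_of_natDegree_lt (by omega)]
    simp

lemma aeval_eq_of_natDegree_le_two {P : ℤ[X]} (hP : P.natDegree ≤ 2) (ξ : ℝ) :
    aeval ξ P = (P.coeff 0 : ℝ) + P.coeff 1 * ξ + P.coeff 2 * ξ ^ 2 := by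
  conv_lhs => rw [eq_quadratic hP]
  simp
  ring

lemma NotQuadratic.aeval_ne_zero (hq : NotQuadratic ξ) {P : ℤ[X]} (hP : P ≠ 0)
    (hdeg : P.natDegree ≤ 2) : aeval ξ P ≠ 0 := by
  intro h
  rw [aeval_eq_of_natDegree_le_two hdeg] at h
  obtain ⟨h0, h1, h2⟩ := hq _ _ _ h
  apply hP
  rw [eq_quadratic hdeg, h0, h1, h2]
  simp

lemma abs_coeff_le_polyHeight (P : ℤ[X]) (i : ℕ) : |(P.coeff i : ℝ)| ≤ polyHeight P := by
  have := P.le_supNorm i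
  rwa [Int.norm_eq_abs] at this

lemma polyHeight_nonneg (P : ℤ[X]) : 0 ≤ polyHeight P := P.supNorm_nonneg

lemma one_le_polyHeight {P : ℤ[X]} (hP : P ≠ 0) : 1 ≤ polyHeight P := by
  have h1 := abs_coeff_le_polyHeight P P.natDegree
  have h2 : (1 : ℝ) ≤ |(P.coeff P.natDegree : ℝ)| := by
    exact_mod_cast Int.one_le_abs (leadingCoeff_ne_zero.2 hP)
  exact h2.trans h1

lemma polyHeight_le {P : ℤ[X]} {B : ℝ} (h : ∀ i, |(P.coeff i : ℝ)| ≤ B) : polyHeight P ≤ B := by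
  obtain ⟨i, hi⟩ := P.exists_eq_supNorm
  rw [polyHeight, hi, Int.norm_eq_abs]
  exact h i

/-! ### The lower bound for quadratic polynomials -/

namespace IsExtremalSeq

variable {K : ℝ} {a b d : ℕ → ℕ}

lemma cast_pos (h : IsExtremalSeq ξ K a b d) (k : ℕ) : (0 : ℝ) < b k := by
  exact_mod_cast h.one_le k

lemma tendsto_rpow (h : IsExtremalSeq ξ K a b d) :
    Filter.Tendsto (fun k => (b k : ℝ) ^ invGolden) Filter.atTop Filter.atTop :=
  (tendsto_rpow_atTop invGolden_pos).comp
    (tendsto_natCast_atTop_atTop.comp h.mono.tendsto_atTop)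

/-- Some point of the triple gives a non-zero integer value of the form. That value differs from
n·P(ξ) by at most 2H(P)L(a_k), and the size condition on k makes this at most 1/2. -/
lemma half_le_mul_abs_aeval (h : IsExtremalSeq ξ K a b d) {P : ℤ[X]} (hP : P ≠ 0)
    (hdeg : P.natDegree ≤ 2) {k : ℕ} (hk : 4 * K * polyHeight P ≤ (b k : ℝ) ^ invGolden) :
    1 / 2 ≤ d k * |aeval ξ P| := by
  have hH := one_le_polyHeight hP
  have hp := Real.rpow_pos_of_pos (h.cast_pos k) invGolden
  have herr : simErr ξ (a k) * (4 * polyHeight P) ≤ 1 := by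
    have h1 := h.err_left k
    rw [Real.rpow_neg (h.cast_pos k).le, ← div_eq_mul_inv, le_div_iff₀ hp] at h1
    have hK : 0 ≤ K := nonneg_of_mul_nonneg_left
      ((simErr_nonneg ξ (a k)).trans (h.err_left k))
      (Real.rpow_pos_of_pos (h.cast_pos k) _)
    have h2 : K * (simErr ξ (a k) * (4 * polyHeight P)) ≤ K := by
      calc K * (simErr ξ (a k) * (4 * polyHeight P))
          = simErr ξ (a k) * (4 * K * polyHeight P) := by ring
        _ ≤ simErr ξ (a k) * (b k : ℝ) ^ invGolden := by
            gcongr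
            exact simErr_nonneg _ _
        _ ≤ K := h1
    rcases hK.eq_or_lt with h0 | h0
    · have : simErr ξ (a k) = 0 := by
        rw [← h0] at h1
        exact le_antisymm (nonpos_of_mul_nonpos_left h1 hp) (simErr_nonneg _ _)
      rw [this]
      norm_num
    · exact le_of_mul_le_mul_left (by linarith) h0
  have key : ∀ n : ℕ, n ≤ d k → simErr ξ n ≤ simErr ξ (a k) →
      pairing ξ (P.coeff 0) (P.coeff 1) (P.coeff 2) n ≠ 0 → 1 / 2 ≤ d k * |aeval ξ P| := by
    intro n hn hle hne
    have h1 := abs_pairing_sub_le ξ (P.coeff 0) (P.coeff 1) (P.coeff 2) n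
    rw [← aeval_eq_of_natDegree_le_two hdeg] at h1
    have h2 : (1 : ℝ) ≤ |(pairing ξ (P.coeff 0) (P.coeff 1) (P.coeff 2) n : ℝ)| := by
      exact_mod_cast Int.one_le_abs hne
    have h3 := abs_sub_abs_le_abs_sub
      (pairing ξ (P.coeff 0) (P.coeff 1) (P.coeff 2) n : ℝ) (n * aeval ξ P)
    have h4 : (|(P.coeff 1 : ℝ)| + |(P.coeff 2 : ℝ)|) * simErr ξ n ≤
        (polyHeight P + polyHeight P) * simErr ξ (a k) := by
      have := simErr_nonneg ξ n
      have := abs_coeff_le_polyHeight P 1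
      have := abs_coeff_le_polyHeight P 2
      gcongr
    have h5 : (n : ℝ) * |aeval ξ P| ≤ d k * |aeval ξ P| := by
      gcongr
    rw [abs_mul, Nat.abs_cast] at h3
    linarith
  by_contra hcon
  have h1 := h.lt_left k
  have h2 := h.lt_right k
  have h3 := h.err_mid_lt k
  have h4 := h.err_right_lt k
  have hn : pairing ξ (P.coeff 0) (P.coeff 1) (P.coeff 2) (a k) = 0 := by
    by_contra hne
    exact hcon (key _ (h1.trans h2).le le_rfl hne)
  have hm : pairing ξ (P.coeff 0) (P.coeff 1) (P.coeff 2) (b k) = 0 := by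
    by_contra hne
    exact hcon (key _ h2.le h3.le hne)
  have hd : pairing ξ (P.coeff 0) (P.coeff 1) (P.coeff 2) (d k) = 0 := by
    by_contra hne
    exact hcon (key _ le_rfl (h4.trans h3).le hne)
  obtain ⟨e0, e1, e2⟩ := pairing_eq_zero (h.tripleDet_ne k) hn hm hd
  apply hP
  rw [eq_quadratic hdeg, e0, e1, e2]
  simp

lemma exists_lower_bound (h : IsExtremalSeq ξ K a b d) (hK : 0 < K) :
    ∃ c₂ : ℝ, 0 < c₂ ∧ ∀ P : ℤ[X], P ≠ 0 → P.natDegree ≤ 2 →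
      c₂ * polyHeight P ^ (-(Real.goldenRatio ^ 3)) < |aeval ξ P| := by
  set γ := Real.goldenRatio with hγ
  have hγ0 : 0 < γ := Real.goldenRatio_pos
  -- The nested powers follow the chain H → b_k → b_{k+1} → d_{k+1}, each step raising to the power
  -- γ; the term `d 0` covers the case where the least index is 0.
  set M : ℝ := (K * (K * (4 * K) ^ γ) ^ γ) ^ γ + d 0
  have hM : 0 < M := by positivity
  refine ⟨1 / (4 * M), by positivity, fun P hP hdeg => ?_⟩
  have hH := one_le_polyHeight hP
  set H := polyHeight P
  have hH0 : 0 < H := by linarith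
  have hHγ : 1 ≤ H ^ (γ ^ 3) := Real.one_le_rpow hH (by positivity)
  have hex : ∃ k, 4 * K * H ≤ (b k : ℝ) ^ invGolden :=
    (h.tendsto_rpow.eventually_ge_atTop _).exists
  classical
  have hk := Nat.find_spec hex
  have hmin : ∀ l, l < Nat.find hex → (b l : ℝ) ^ invGolden < 4 * K * H :=
    fun l hl => not_le.1 (Nat.find_min hex hl)
  generalize Nat.find hex = k at hk hmin
  have hd : (d k : ℝ) ≤ M * H ^ (γ ^ 3) := by
    rcases k with _ | k
    · calc (d 0 : ℝ) ≤ M := le_add_of_nonneg_left (by positivity)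
        _ ≤ M * H ^ (γ ^ 3) := le_mul_of_one_le_right hM.le hHγ
    · have h1 : (b k : ℝ) ≤ (4 * K * H) ^ γ :=
        le_rpow_goldenRatio (Nat.cast_nonneg _) (hmin k (Nat.lt_add_one k)).le
      have h2 : (b (k + 1) : ℝ) ≤ (K * (4 * K * H) ^ γ) ^ γ :=
        le_rpow_goldenRatio (Nat.cast_nonneg _) ((h.succ_le k).trans (by gcongr))
      have h3 : (d (k + 1) : ℝ) ≤ (K * (K * (4 * K * H) ^ γ) ^ γ) ^ γ :=
        le_rpow_goldenRatio (Nat.cast_nonneg _) ((h.right_le (k + 1)).trans (by gcongr))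
      have e : (K * (K * (4 * K * H) ^ γ) ^ γ) ^ γ =
          (K * (K * (4 * K) ^ γ) ^ γ) ^ γ * H ^ (γ ^ 3) := by
        rw [Real.mul_rpow (by positivity : 0 ≤ 4 * K) hH0.le, ← mul_assoc,
          Real.mul_rpow (by positivity : 0 ≤ K * (4 * K) ^ γ) (by positivity), ← mul_assoc,
          Real.mul_rpow (by positivity : 0 ≤ K * (K * (4 * K) ^ γ) ^ γ) (by positivity),
          ← Real.rpow_mul hH0.le, ← Real.rpow_mul hH0.le]
        congr 2
        ring
      rw [e] at h3
      refine h3.trans ?_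
      gcongr
      exact le_add_of_nonneg_right (Nat.cast_nonneg _)
  have h1 := (h.half_le_mul_abs_aeval hP hdeg hk).trans
    (mul_le_mul_of_nonneg_right hd (abs_nonneg _))
  rw [Real.rpow_neg hH0.le, ← div_eq_mul_inv, div_div, div_lt_iff₀ (by positivity)]
  linarith

/-! ### Good quadratic polynomials -/

/-- The coefficients of P are the cross product of the points n = b_k and m = b_{k+1}, with t = n^θ
≍ m/n. They are ≪ m·L(n) ≪ t, and |P(ξ)| ≪ L(n)L(m) ≪ 1/(nm). -/
lemma exists_good_polynomial (h : IsExtremalSeq ξ K a b d) (hK : 0 < K) :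
    ∃ B : ℝ, 0 < B ∧ ∀ T : ℝ, ∃ t : ℝ, T ≤ t ∧ 1 ≤ t ∧ ∃ P : ℤ[X], P ≠ 0 ∧ P.natDegree ≤ 2 ∧
      polyHeight P ≤ B * t ∧ |aeval ξ P| ≤ B * t ^ (-(Real.goldenRatio ^ 3)) ∧
      t ≤ B * |aeval ξ (derivative P)| := by
  set γ := Real.goldenRatio with hγ
  have hγ0 : 0 < γ := Real.goldenRatio_pos
  set A : ℝ := K ^ γ
  have hA : 0 < A := by positivity
  set B₁ : ℝ := 2 * K * A
  set B₂ : ℝ := 1 + |ξ| * B₁ + |ξ| ^ 2 * B₁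
  have hB₁ : 0 < B₁ := by positivity
  have hB₂ : 0 < B₂ := by positivity
  refine ⟨B₁ + B₂ + 2 * K ^ 2 * A + 2 * A, by positivity, fun T => ?_⟩
  obtain ⟨k, hkT, hk⟩ := ((h.tendsto_rpow.eventually_ge_atTop T).and
    (h.tendsto_rpow.eventually_ge_atTop (4 * (2 * |ξ| + 1) * K * A * A))).exists
  have hn : (0 : ℝ) < b k := h.cast_pos k
  have hm : (0 : ℝ) < b (k + 1) := h.cast_pos (k + 1)
  set n := b k with hn_def
  set m := b (k + 1) with hm_def
  set t : ℝ := (n : ℝ) ^ invGolden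
  have hn1 : (1 : ℝ) ≤ n := by exact_mod_cast h.one_le k
  have ht1 : 1 ≤ t := Real.one_le_rpow hn1 invGolden_pos.le
  have ht0 : 0 < t := by linarith
  have hnt : (n : ℝ) ^ γ = n * t := by
    rw [hγ, goldenRatio_eq, Real.rpow_add hn, Real.rpow_one]
  have hmle : (m : ℝ) ≤ A * (n * t) := by
    have := le_rpow_goldenRatio hm.le (h.succ_le k)
    rwa [Real.mul_rpow hK.le hn.le, ← hγ, hnt] at this
  have hlem : n * t ≤ A * m := by
    have := Real.rpow_le_rpow hn.le (h.le_succ k) hγ0.le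
    rwa [hnt, Real.mul_rpow hK.le (by positivity), ← Real.rpow_mul hm.le,
      invGolden_mul_goldenRatio, Real.rpow_one] at this
  have hLn := h.err_mid k
  have hLm := h.err_mid (k + 1)
  rw [← hn_def] at hLn
  rw [← hm_def] at hLm
  have hLn0 := simErr_nonneg ξ n
  have hLm0 := simErr_nonneg ξ m
  have hmL : (m : ℝ) * simErr ξ n ≤ K * A * t := by
    calc (m : ℝ) * simErr ξ n ≤ A * (n * t) * simErr ξ n := by gcongr
      _ = A * t * (n * simErr ξ n) := by ring
      _ ≤ A * t * K := by gcongr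
      _ = K * A * t := by ring
  have hwsum := mul_simErr_add_le (h.mono.monotone (Nat.le_succ k)) (h.err_succ_lt k).le
  have hw1 : |(wedgeOne ξ n m : ℝ)| ≤ B₁ * t := by
    have := (abs_wedgeOne_le ξ n m).trans hwsum
    simp only [B₁]
    linarith
  have hw2 : |(wedgeTwo ξ n m : ℝ)| ≤ B₁ * t := by
    have := (abs_wedgeTwo_le ξ n m).trans hwsum
    simp only [B₁]
    linarith
  have hev := abs_wedge_eval_le ξ n m
  have hw0 : |(wedgeZero ξ n m : ℝ)| ≤ B₂ * t := by
    have e : (wedgeZero ξ n m : ℝ) =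
        ((wedgeZero ξ n m : ℝ) + wedgeOne ξ n m * ξ + wedgeTwo ξ n m * ξ ^ 2) -
        (ξ * wedgeOne ξ n m + ξ ^ 2 * wedgeTwo ξ n m) := by ring
    rw [e]
    refine (abs_sub _ _).trans ?_
    have h1 : |ξ * wedgeOne ξ n m + ξ ^ 2 * wedgeTwo ξ n m| ≤
        |ξ| * (B₁ * t) + |ξ| ^ 2 * (B₁ * t) := by
      refine (abs_add_le _ _).trans ?_
      rw [abs_mul, abs_mul, abs_pow]
      gcongr
    have h2 : 2 * (simErr ξ n * simErr ξ m) ≤ 1 := by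
      nlinarith [simErr_le_half ξ n, simErr_le_half ξ m]
    simp only [B₂]
    linarith
  set P : ℤ[X] := C (wedgeTwo ξ n m) * X ^ 2 + C (wedgeOne ξ n m) * X + C (wedgeZero ξ n m)
    with hP_def
  have hdeg : P.natDegree ≤ 2 := natDegree_quadratic_le
  have hPev : aeval ξ P =
      (wedgeZero ξ n m : ℝ) + wedgeOne ξ n m * ξ + wedgeTwo ξ n m * ξ ^ 2 := by
    simp [hP_def]
    ring
  have hPd : aeval ξ (derivative P) = (wedgeOne ξ n m : ℝ) + 2 * ξ * wedgeTwo ξ n m := by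
    simp [hP_def, map_ofNat]
    ring
  -- P'(ξ) = m·αn − n·αm. The first term is ≫ m/n ≫ t because the Hankel determinant at n is
  -- non-zero; the second is ≪ n/m ≪ 1/t, and the second threshold imposed on k makes it negligible.
  have hderiv : t ≤ 2 * A * |aeval ξ (derivative P)| := by
    set αn := 2 * ξ * ((n : ℝ) * ξ - nearOne ξ n) - ((n : ℝ) * ξ ^ 2 - nearTwo ξ n) with hαn
    set αm := 2 * ξ * ((m : ℝ) * ξ - nearOne ξ m) - ((m : ℝ) * ξ ^ 2 - nearTwo ξ m) with hαm
    have e : aeval ξ (derivative P) = m * αn - n * αm := by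
      rw [hPd, hαn, hαm, wedgeOne, wedgeTwo]
      push_cast
      ring
    -- The constant is 1 − (1/2)²: n·αn differs from a non-zero integer by the square of a rounding
    -- error.
    have h1 : 3 / 4 ≤ n * |αn| := by
      have h2 : (1 : ℝ) ≤ |(hankelDet ξ n : ℝ)| := by
        exact_mod_cast Int.one_le_abs (h.hankelDet_ne k)
      rw [hankelDet_eq, ← hαn] at h2
      have h3 := abs_sub ((n : ℝ) * αn) (((n : ℝ) * ξ - nearOne ξ n) ^ 2)
      have h4 : |((n : ℝ) * ξ - nearOne ξ n) ^ 2| ≤ 1 / 4 := by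
        rw [abs_pow]
        calc _ ≤ (1 / 2 : ℝ) ^ 2 := by
              gcongr
              exact (abs_sub_nearOne_le ξ n).trans (simErr_le_half ξ n)
          _ = _ := by norm_num
      rw [abs_mul, Nat.abs_cast] at h3
      linarith
    have h5 : |αm| ≤ (2 * |ξ| + 1) * simErr ξ m := abs_two_mul_sub_le ξ m
    have h6 : 3 / 4 * t ≤ A * (m * |αn|) := by
      calc 3 / 4 * t ≤ n * |αn| * t := by gcongr
        _ = n * t * |αn| := by ring
        _ ≤ A * m * |αn| := by gcongr
        _ = _ := by ring
    have h7 : A * (n * |αm|) ≤ 1 / 4 * t := by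
      have h8 : (n * t) * |αm| ≤ A * (2 * |ξ| + 1) * K := by
        calc (n * t) * |αm| ≤ A * m * ((2 * |ξ| + 1) * simErr ξ m) := by gcongr
          _ = A * (2 * |ξ| + 1) * (m * simErr ξ m) := by ring
          _ ≤ _ := by gcongr
      have h9 : t * (A * (n * |αm|)) ≤ t * (1 / 4 * t) := by
        calc t * (A * (n * |αm|)) = A * ((n * t) * |αm|) := by ring
          _ ≤ A * (A * (2 * |ξ| + 1) * K) := by gcongr
          _ = 1 / 4 * (4 * (2 * |ξ| + 1) * K * A * A) := by ring
          _ ≤ 1 / 4 * t := by gcongr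
          _ ≤ t * (1 / 4 * t) := le_mul_of_one_le_left (by positivity) ht1
      exact le_of_mul_le_mul_left h9 ht0
    have h10 := abs_sub_abs_le_abs_sub ((m : ℝ) * αn) (n * αm)
    rw [abs_mul, abs_mul, Nat.abs_cast, Nat.abs_cast, ← e] at h10
    have h11 := mul_le_mul_of_nonneg_left h10 hA.le
    rw [mul_sub] at h11
    linarith
  have hsmall : |aeval ξ P| ≤ 2 * K ^ 2 * A * t ^ (-(γ ^ 3)) := by
    -- Here θγ³ = γ² = 2 + θ, and n·t is comparable to m.
    have hpow : t ^ (γ ^ 3) = n * (n * t) := by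
      have hexp : invGolden * γ ^ 3 = 1 + (1 + invGolden) := by
        have h1 : invGolden * γ = 1 := invGolden_mul_goldenRatio
        have h2 : γ ^ 2 = γ + 1 := Real.goldenRatio_sq
        have h3 : γ = 1 + invGolden := goldenRatio_eq
        calc invGolden * γ ^ 3 = (invGolden * γ) * γ ^ 2 := by ring
          _ = 1 + (1 + invGolden) := by rw [h1, h2, h3]; ring
      rw [← Real.rpow_mul hn.le, hexp, Real.rpow_add hn, Real.rpow_add hn, Real.rpow_one]
    rw [hPev]
    refine hev.trans ?_
    rw [Real.rpow_neg ht0.le, hpow, ← div_eq_mul_inv, le_div_iff₀ (by positivity)]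
    calc 2 * (simErr ξ n * simErr ξ m) * (n * (n * t))
        ≤ 2 * (simErr ξ n * simErr ξ m) * (n * (A * m)) := by gcongr
      _ = 2 * A * ((n * simErr ξ n) * (m * simErr ξ m)) := by ring
      _ ≤ 2 * A * (K * K) := by gcongr
      _ = _ := by ring
  refine ⟨t, hkT, ht1, P, ?_, hdeg, ?_, ?_, ?_⟩
  · intro h0
    rw [h0] at hderiv
    simp at hderiv
    linarith
  · have hsum0 : 0 ≤ 2 * K ^ 2 * A + 2 * A := by positivity
    apply polyHeight_le
    intro i
    have hc : ∀ x y : ℝ, |x| ≤ y * t → y ≤ B₁ + B₂ + 2 * K ^ 2 * A + 2 * A →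
        |x| ≤ (B₁ + B₂ + 2 * K ^ 2 * A + 2 * A) * t := fun x y hxy hy =>
      hxy.trans (mul_le_mul_of_nonneg_right hy ht0.le)
    rcases i with _ | _ | _ | i
    · refine hc _ B₂ ?_ (by linarith)
      simpa [hP_def] using hw0
    · refine hc _ B₁ ?_ (by linarith)
      simpa [hP_def, coeff_C, -eq_intCast] using hw1
    · refine hc _ B₁ ?_ (by linarith)
      simpa [hP_def, coeff_X, coeff_C, -eq_intCast] using hw2
    · rw [coeff_eq_zero_of_natDegree_lt (by omega)]
      simp
      positivity
  · refine hsmall.trans ?_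
    gcongr
    linarith
  · refine hderiv.trans ?_
    gcongr
    have : 0 ≤ 2 * K ^ 2 * A := by positivity
    linarith

end IsExtremalSeq

/-! ### Heights of algebraic numbers -/

lemma intMinpoly_ne_zero (α : ℂ) : intMinpoly α ≠ 0 := primPart_ne_zero _

lemma natDegree_intMinpoly_le (α : ℂ) :
    (intMinpoly α).natDegree ≤ (minpoly ℚ α).natDegree := by
  rw [intMinpoly, natDegree_primPart]
  exact natDegree_le_natDegree (Finset.max_mono (IsLocalization.integerNormalization_support _ _))

lemma aeval_intMinpoly (α : ℂ) (hα : IsAlgebraic ℚ α) : aeval α (intMinpoly α) = 0 := by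
  apply aeval_primPart_eq_zero
  · rw [Ne, IsFractionRing.integerNormalization_eq_zero_iff]
    exact minpoly.ne_zero hα.isIntegral
  · exact IsLocalization.integerNormalization_aeval_eq_zero _ _ (minpoly.aeval ℚ α)

lemma map_intMinpoly_dvd (α : ℂ) :
    (intMinpoly α).map (Int.castRingHom ℚ) ∣ minpoly ℚ α := by
  obtain ⟨b, hb, hmap⟩ := IsLocalization.integerNormalization_spec (nonZeroDivisors ℤ)
    (minpoly ℚ α)
  rw [intMinpoly]
  generalize IsLocalization.integerNormalization (nonZeroDivisors ℤ) (minpoly ℚ α) = Q at hmap ⊢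
  have hb0 : (b : ℚ) ≠ 0 := by exact_mod_cast nonZeroDivisors.ne_zero hb
  have h1 : Q.map (Int.castRingHom ℚ) = C (b : ℚ) * minpoly ℚ α := by
    rw [← smul_eq_C_mul, Int.cast_smul_eq_zsmul]
    exact hmap
  have h2 : Q.primPart.map (Int.castRingHom ℚ) ∣ C (b : ℚ) * minpoly ℚ α := by
    rw [← h1]
    exact Polynomial.map_dvd _ Q.primPart_dvd
  exact (isUnit_C.2 (isUnit_iff_ne_zero.2 hb0)).dvd_mul_left.1 h2

/-- Gauss's lemma: divisibility over ℚ by a primitive polynomial descends to ℤ. -/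
lemma intMinpoly_dvd {α : ℂ} {P : ℤ[X]} (h : aeval α P = 0) : intMinpoly α ∣ P := by
  have hprim : (intMinpoly α).IsPrimitive := isPrimitive_primPart _
  rw [IsPrimitive.Int.dvd_iff_map_cast_dvd_map_cast _ _ hprim]
  refine (map_intMinpoly_dvd α).trans (minpoly.dvd ℚ α ?_)
  rw [← h]
  exact aeval_map_algebraMap ℚ α P

lemma supNorm_map_le_polyHeight (P : ℤ[X]) :
    (P.map (Int.castRingHom ℂ)).supNorm ≤ polyHeight P := by
  obtain ⟨i, hi⟩ := (P.map (Int.castRingHom ℂ)).exists_eq_supNorm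
  rw [hi, coeff_map, eq_intCast, Complex.norm_intCast]
  exact abs_coeff_le_polyHeight P i

lemma mahlerMeasure_le_polyHeight {P : ℤ[X]} (hdeg : P.natDegree ≤ 2) :
    (P.map (Int.castRingHom ℂ)).mahlerMeasure ≤ 2 * polyHeight P := by
  refine (mahlerMeasure_le_sqrt_natDegree_add_one_mul_supNorm _).trans ?_
  have h1 : ((P.map (Int.castRingHom ℂ)).natDegree : ℝ) ≤ 2 := by
    exact_mod_cast natDegree_map_le.trans hdeg
  have h2 : √(((P.map (Int.castRingHom ℂ)).natDegree : ℝ) + 1) ≤ 2 := by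
    rw [Real.sqrt_le_left (by norm_num)]
    linarith
  exact mul_le_mul h2 (supNorm_map_le_polyHeight P) (supNorm_nonneg _) (by norm_num)

/-- A factor of an integer polynomial of degree at most two has comparable height. -/
lemma polyHeight_le_of_dvd {P Q : ℤ[X]} (hP : P ≠ 0) (hdeg : P.natDegree ≤ 2) (h : Q ∣ P) :
    polyHeight Q ≤ 4 * polyHeight P := by
  have hQdeg := (natDegree_le_of_dvd h hP).trans hdeg
  obtain ⟨R, rfl⟩ := h
  have hR : R ≠ 0 := right_ne_zero_of_mul hP
  apply polyHeight_le
  intro i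
  -- The cofactor has Mahler measure at least 1, so the measure of `Q` is at most that of the
  -- product. The factor 4 combines a binomial coefficient at most 2 with the 2 relating measure to
  -- height.
  have h1 := norm_coeff_le_choose_mul_mahlerMeasure_of_one_le_mahlerMeasure i
    (Q.map (Int.castRingHom ℂ)) (R.map (Int.castRingHom ℂ)) (one_le_mahlerMeasure_of_ne_zero hR)
  rw [← Polynomial.map_mul, coeff_map, eq_intCast, Complex.norm_intCast] at h1
  refine h1.trans ?_
  have h2 : (((Q.map (Int.castRingHom ℂ)).natDegree.choose i : ℕ) : ℝ) ≤ 2 := by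
    have h3 : (Q.map (Int.castRingHom ℂ)).natDegree ≤ 2 := natDegree_map_le.trans hQdeg
    have h4 := (Nat.choose_le_choose i h3).trans (Nat.choose_le_middle i 2)
    exact_mod_cast h4
  calc _ ≤ 2 * (2 * polyHeight (Q * R)) :=
        mul_le_mul h2 (mahlerMeasure_le_polyHeight hdeg) (mahlerMeasure_nonneg _) (by norm_num)
    _ = _ := by ring

lemma finite_polyHeight_le (B : ℝ) :
    {P : ℤ[X] | P.natDegree ≤ 2 ∧ polyHeight P ≤ B}.Finite := by
  refine (finite_mahlerMeasure_le 2 (2 * B).toNNReal).subset fun P hP => ⟨hP.1, ?_⟩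
  refine (mahlerMeasure_le_polyHeight hP.1).trans (le_trans ?_ (Real.le_coe_toNNReal _))
  linarith [hP.2]

lemma finite_algHeight_le (B : ℝ) :
    {α : ℂ | IsAlgebraic ℚ α ∧ (minpoly ℚ α).natDegree ≤ 2 ∧ algHeight α ≤ B}.Finite := by
  refine ((finite_polyHeight_le B).biUnion fun P _ => P.rootSet_finite ℂ).subset ?_
  rintro α ⟨hα, hdeg, hB⟩
  refine Set.mem_biUnion ⟨(natDegree_intMinpoly_le α).trans hdeg, hB⟩ ?_
  rw [mem_rootSet]
  exact ⟨intMinpoly_ne_zero α, aeval_intMinpoly α hα⟩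

/-! ### Small values at `ξ` and roots close to `ξ` -/

lemma abs_aeval_le_of_root {P : ℤ[X]} (hdeg : P.natDegree ≤ 2) {α : ℂ} (hα : aeval α P = 0)
    (hle : ‖(ξ : ℂ) - α‖ ≤ 1) :
    |aeval ξ P| ≤ (2 * |ξ| + 2) * (polyHeight P * ‖(ξ : ℂ) - α‖) := by
  have e : ((aeval ξ P : ℝ) : ℂ) =
      ((ξ : ℂ) - α) * ((P.coeff 1 : ℂ) + P.coeff 2 * (ξ + α)) := by
    have h1 : aeval α P = (P.coeff 0 : ℂ) + P.coeff 1 * α + P.coeff 2 * α ^ 2 := by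
      conv_lhs => rw [eq_quadratic hdeg]
      simp
      ring
    rw [hα] at h1
    rw [aeval_eq_of_natDegree_le_two hdeg]
    push_cast
    linear_combination -h1
  have hαle : ‖α‖ ≤ |ξ| + 1 := by
    have := norm_sub_norm_le α ξ
    rw [norm_sub_rev, Complex.norm_real, Real.norm_eq_abs] at this
    linarith
  have hsum : ‖(P.coeff 1 : ℂ) + P.coeff 2 * (ξ + α)‖ ≤ (2 * |ξ| + 2) * polyHeight P := by
    refine (norm_add_le _ _).trans ?_
    rw [norm_mul, Complex.norm_intCast, Complex.norm_intCast]
    have h1 := abs_coeff_le_polyHeight P 1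
    have h2 := abs_coeff_le_polyHeight P 2
    have h3 : ‖(ξ : ℂ) + α‖ ≤ 2 * |ξ| + 1 := by
      refine (norm_add_le _ _).trans ?_
      rw [Complex.norm_real, Real.norm_eq_abs]
      linarith
    have h4 := mul_le_mul h2 h3 (norm_nonneg _) (polyHeight_nonneg P)
    linarith
  rw [← Real.norm_eq_abs, ← Complex.norm_real, e, norm_mul]
  calc _ ≤ ‖(ξ : ℂ) - α‖ * ((2 * |ξ| + 2) * polyHeight P) := by gcongr
    _ = _ := by ring

/-- A polynomial of degree at most two has a root close to any point at which its value is small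
compared with its derivative. -/
lemma exists_root_near {P : ℤ[X]} (hdeg : P.natDegree ≤ 2) (h0 : aeval ξ P ≠ 0)
    (h1 : aeval ξ (derivative P) ≠ 0) :
    ∃ α : ℂ, aeval α P = 0 ∧ ‖(ξ : ℂ) - α‖ * |aeval ξ (derivative P)| ≤ 4 * |aeval ξ P| := by
  by_contra! hcon
  set f : ℂ[X] := P.map (algebraMap ℤ ℂ) with hf
  have hev : ∀ Q : ℤ[X], (Q.map (algebraMap ℤ ℂ)).eval (ξ : ℂ) = ((aeval ξ Q : ℝ) : ℂ) := by
    intro Q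
    rw [eval_map_algebraMap]
    exact aeval_algebraMap_apply ℂ ξ Q
  have hfne : f.eval (ξ : ℂ) ≠ 0 := by
    rw [hf, hev]
    exact_mod_cast h0
  have hE := abs_pos.2 h0
  have hD := abs_pos.2 h1
  -- P'(ξ)/P(ξ) is the sum of 1/(ξ − z) over at most two roots z. If both were farther than
  -- 4|P(ξ)|/|P'(ξ)|, the sum would be at most half of |P'(ξ)/P(ξ)|.
  have hsum := (IsAlgClosed.splits f).eval_derivative_div_eval_of_ne_zero hfne
  rw [hf, derivative_map, hev, hev, ← hf] at hsum
  have hn := congrArg norm hsum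
  rw [norm_div, Complex.norm_real, Complex.norm_real, Real.norm_eq_abs, Real.norm_eq_abs] at hn
  have hb : ‖(f.roots.map fun z => 1 / ((ξ : ℂ) - z)).sum‖ ≤
      2 * (|aeval ξ (derivative P)| / (4 * |aeval ξ P|)) := by
    refine (norm_multiset_sum_le _).trans ?_
    rw [Multiset.map_map]
    refine (Multiset.sum_le_card_nsmul _ (|aeval ξ (derivative P)| / (4 * |aeval ξ P|)) ?_).trans ?_
    · intro x hx
      obtain ⟨z, hz, rfl⟩ := Multiset.mem_map.1 hx
      have hz0 : aeval z P = 0 := by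
        have := isRoot_of_mem_roots hz
        rwa [IsRoot.def, hf, eval_map_algebraMap] at this
      have hlt := hcon z hz0
      have hpos : 0 < ‖(ξ : ℂ) - z‖ := by
        rcases (norm_nonneg ((ξ : ℂ) - z)).eq_or_lt with h | h
        · rw [← h, zero_mul] at hlt
          linarith
        · exact h
      simp only [Function.comp_apply, norm_div, norm_one]
      rw [div_le_div_iff₀ hpos (by positivity)]
      linarith
    · rw [Multiset.card_map, nsmul_eq_mul]
      gcongr
      exact_mod_cast (card_roots' f).trans (natDegree_map_le.trans hdeg)
  rw [← hn] at hb
  have : 2 * (|aeval ξ (derivative P)| / (4 * |aeval ξ P|)) =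
      |aeval ξ (derivative P)| / |aeval ξ P| / 2 := by
    field_simp
    norm_num
  rw [this] at hb
  have : 0 < |aeval ξ (derivative P)| / |aeval ξ P| := by positivity
  linarith

/-! ### Exponents -/

/-- On a finite set a positive function would attain a positive minimum. -/
lemma infinite_of_forall_exists_lt {α : Type*} {S : Set α} (f : α → ℝ)
    (hpos : ∀ s ∈ S, 0 < f s) (h : ∀ ε > 0, ∃ s ∈ S, f s < ε) : S.Infinite := by
  intro hfin
  obtain ⟨s₀, hs₀, -⟩ := h 1 one_pos
  obtain ⟨m, hm, hmin⟩ := hfin.toFinset.exists_min_image f ⟨s₀, hfin.mem_toFinset.2 hs₀⟩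
  obtain ⟨s, hs, hlt⟩ := h (f m) (hpos m (hfin.mem_toFinset.1 hm))
  exact absurd (hmin s (hfin.mem_toFinset.2 hs)) (not_le.2 hlt)

lemma coe_le_iSup_of_forall_lt {S : Set ℝ} {g : ℝ} (hg : 0 < g)
    (h : ∀ w, 0 < w → w < g → w ∈ S) : (g : EReal) ≤ ⨆ w ∈ S, (w : EReal) := by
  refine le_of_forall_lt fun z hz => ?_
  obtain ⟨r, hzr, hrg⟩ := EReal.lt_iff_exists_real_btwn.1 hz
  have hrg' : r < g := EReal.coe_lt_coe_iff.1 hrg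
  -- The maximum with `g / 2` keeps the exponent positive, as `h` requires.
  have hw : max r (g / 2) ∈ S := h _ (lt_max_of_lt_right (by linarith)) (max_lt hrg' (by linarith))
  exact (hzr.trans_le (EReal.coe_le_coe_iff.2 (le_max_left _ _))).trans_le
    (le_iSup₂ (f := fun (w : ℝ) (_ : w ∈ S) => (w : EReal)) _ hw)

lemma le_of_rpow_neg_le {c₂ M H g w : ℝ} (hc : 0 < c₂) (hH : 1 ≤ H) (hw : g < w)
    (h : c₂ * H ^ (-g) ≤ M * H ^ (-w)) : H ≤ (M / c₂) ^ (1 / (w - g)) := by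
  have hH0 : 0 < H := by linarith
  have hp := Real.rpow_pos_of_pos hH0 w
  have h1 := mul_le_mul_of_nonneg_right h hp.le
  rw [mul_assoc, mul_assoc, ← Real.rpow_add hH0, ← Real.rpow_add hH0, neg_add_cancel,
    Real.rpow_zero, mul_one, neg_add_eq_sub] at h1
  have h2 : H ^ (w - g) ≤ M / c₂ := by
    rw [le_div_iff₀ hc]
    linarith
  have h3 := Real.rpow_le_rpow (by positivity) h2 (by
    have : 0 < w - g := by linarith
    positivity : 0 ≤ 1 / (w - g))
  rwa [← Real.rpow_mul hH0.le, mul_one_div_cancel (by linarith), Real.rpow_one] at h3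

lemma eventually_mul_rpow_neg_le {A B g w : ℝ} (hB : 0 < B) (hw : w < g) :
    ∀ᶠ t : ℝ in Filter.atTop, A * t ^ (-g) ≤ (B * t) ^ (-w) := by
  have h1 := (tendsto_rpow_atTop (sub_pos.2 hw)).eventually_ge_atTop (A / B ^ (-w))
  filter_upwards [h1, Filter.eventually_gt_atTop 0] with t ht ht0
  have hp := Real.rpow_pos_of_pos hB (-w)
  rw [div_le_iff₀ hp] at ht
  have h2 := mul_le_mul_of_nonneg_right ht (Real.rpow_nonneg ht0.le (-g))
  rw [Real.mul_rpow hB.le ht0.le]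
  refine h2.trans (le_of_eq ?_)
  rw [mul_right_comm, ← Real.rpow_add ht0, mul_comm]
  congr 2
  ring

lemma notQuadratic_of_rank (h : 2 < Module.rank ℚ (IntermediateField.adjoin ℚ {ξ})) :
    NotQuadratic ξ := by
  intro a b c habc
  by_contra hne
  let q : ℚ[X] := C (c : ℚ) * X ^ 2 + C (b : ℚ) * X + C (a : ℚ)
  have hq0 : q ≠ 0 := by
    intro h0
    apply hne
    have h1 := congrArg (fun p : ℚ[X] => p.coeff 0) h0
    have h2 := congrArg (fun p : ℚ[X] => p.coeff 1) h0
    have h3 := congrArg (fun p : ℚ[X] => p.coeff 2) h0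
    simp [q, coeff_X, coeff_C, -eq_intCast, -map_intCast] at h1 h2 h3
    exact ⟨h1, h2, h3⟩
  have hqev : aeval ξ q = 0 := by
    rw [← habc]
    simp [q]
    ring
  have hint : IsIntegral ℚ ξ := isAlgebraic_iff_isIntegral.1 ⟨q, hq0, hqev⟩
  have hdeg : (minpoly ℚ ξ).natDegree ≤ 2 :=
    (natDegree_le_of_dvd (minpoly.dvd ℚ ξ hqev) hq0).trans natDegree_quadratic_le
  have : FiniteDimensional ℚ (IntermediateField.adjoin ℚ {ξ}) :=
    IntermediateField.adjoin.finiteDimensional hint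
  rw [← Module.finrank_eq_rank, IntermediateField.adjoin.finrank hint] at h
  have h' : 2 < (minpoly ℚ ξ).natDegree := by exact_mod_cast h
  omega

section Exponents

variable {c₂ : ℝ}

/-- For w > g the two bounds on |P(ξ)| confine H(P) to a bounded range, leaving finitely many P. -/
lemma mahlerExponent_two_le {g : ℝ} (hc : 0 < c₂)
    (hlow : ∀ P : ℤ[X], P ≠ 0 → P.natDegree ≤ 2 → c₂ * polyHeight P ^ (-g) < |aeval ξ P|) :
    mahlerExponent 2 ξ ≤ (g : EReal) := by
  refine iSup₂_le fun w hw => EReal.coe_le_coe_iff.2 ?_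
  by_contra! hgw
  refine hw ((finite_polyHeight_le ((1 / c₂) ^ (1 / (w - g)))).subset ?_)
  rintro P ⟨hdeg, hpos, hle⟩
  have hP : P ≠ 0 := by
    rintro rfl
    simp at hpos
  refine ⟨hdeg, le_of_rpow_neg_le hc (one_le_polyHeight hP) hgw ?_⟩
  rw [one_mul]
  exact (hlow P hP hdeg).le.trans hle

/-- The lower bound is applied to the minimal polynomial of α, whose value at ξ is ≪ H(α)|ξ − α|. -/
lemma koksmaExponent_two_le {g : ℝ} (hg : 0 < g) (hc : 0 < c₂)
    (hlow : ∀ P : ℤ[X], P ≠ 0 → P.natDegree ≤ 2 → c₂ * polyHeight P ^ (-g) < |aeval ξ P|) :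
    koksmaExponent 2 ξ ≤ (g : EReal) := by
  refine iSup₂_le fun w hw => EReal.coe_le_coe_iff.2 ?_
  by_contra! hgw
  refine hw ((finite_algHeight_le (((2 * |ξ| + 2) / c₂) ^ (1 / (w - g)))).subset ?_)
  rintro α ⟨hα, hdeg, hle⟩
  refine ⟨hα, hdeg, ?_⟩
  have hP := intMinpoly_ne_zero α
  have hPdeg := (natDegree_intMinpoly_le α).trans hdeg
  have hH : 1 ≤ algHeight α := one_le_polyHeight hP
  have hH0 : 0 < algHeight α := by linarith
  refine le_of_rpow_neg_le hc hH hgw ((hlow _ hP hPdeg).le.trans ?_)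
  have hle1 : ‖(ξ : ℂ) - α‖ ≤ 1 :=
    hle.trans (Real.rpow_le_one_of_one_le_of_nonpos hH (by linarith))
  refine (abs_aeval_le_of_root hPdeg (aeval_intMinpoly α hα) hle1).trans ?_
  change (2 * |ξ| + 2) * (algHeight α * ‖(ξ : ℂ) - α‖) ≤ _
  gcongr
  calc algHeight α * ‖(ξ : ℂ) - α‖ ≤ algHeight α * algHeight α ^ (-w - 1) := by gcongr
    _ = algHeight α ^ (-w) := by
        rw [Real.rpow_sub_one hH0.ne']
        field_simp

/-- A family of integer polynomials of degree at most two taking small values at `ξ` and having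
large derivatives there. -/
def HasGoodPolynomials (ξ g B : ℝ) : Prop :=
  ∀ T : ℝ, ∃ t : ℝ, T ≤ t ∧ 1 ≤ t ∧ ∃ P : ℤ[X], P ≠ 0 ∧ P.natDegree ≤ 2 ∧
    polyHeight P ≤ B * t ∧ |aeval ξ P| ≤ B * t ^ (-g) ∧ t ≤ B * |aeval ξ (derivative P)|

variable {g B : ℝ}

lemma exists_eventually_of_hasGoodPolynomials (h : HasGoodPolynomials ξ g B) {p : ℝ → Prop}
    (hp : ∀ᶠ t in Filter.atTop, p t) :
    ∃ t : ℝ, p t ∧ 1 ≤ t ∧ ∃ P : ℤ[X], P ≠ 0 ∧ P.natDegree ≤ 2 ∧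
      polyHeight P ≤ B * t ∧ |aeval ξ P| ≤ B * t ^ (-g) ∧
      t ≤ B * |aeval ξ (derivative P)| := by
  obtain ⟨T, hT⟩ := Filter.eventually_atTop.1 hp
  obtain ⟨t, htT, h1⟩ := h T
  exact ⟨t, hT t htT, h1⟩

lemma eventually_mul_rpow_neg_lt (A : ℝ) {ε : ℝ} (hg : 0 < g) (hε : 0 < ε) :
    ∀ᶠ t : ℝ in Filter.atTop, A * t ^ (-g) < ε := by
  have : Filter.Tendsto (fun t : ℝ => A * t ^ (-g)) Filter.atTop (nhds 0) := by
    simpa using (tendsto_rpow_neg_atTop hg).const_mul A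
  exact this.eventually_lt_const hε

lemma infinite_good_polynomials (hq : NotQuadratic ξ) (hg : 0 < g) (hB : 0 < B)
    (h : HasGoodPolynomials ξ g B) :
    {P : ℤ[X] | P ≠ 0 ∧ P.natDegree ≤ 2 ∧
      |aeval ξ P| ≤ B * B ^ g * polyHeight P ^ (-g)}.Infinite := by
  refine infinite_of_forall_exists_lt (fun P => |aeval ξ P|)
    (fun P hP => abs_pos.2 (hq.aeval_ne_zero hP.1 hP.2.1)) fun ε hε => ?_
  obtain ⟨t, ht, ht1, P, hP, hdeg, hH, hle, -⟩ :=
    exists_eventually_of_hasGoodPolynomials h (eventually_mul_rpow_neg_lt B hg hε)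
  refine ⟨P, ⟨hP, hdeg, hle.trans ?_⟩, hle.trans_lt ht⟩
  have hHpos : 0 < polyHeight P := by linarith [one_le_polyHeight hP]
  -- Passing from t to the height through H(P) ≤ Bt produces the factor `B ^ g`.
  have h1 : (B * t) ^ (-g) ≤ polyHeight P ^ (-g) :=
    Real.rpow_le_rpow_of_nonpos hHpos hH (by linarith)
  rw [Real.mul_rpow hB.le (by linarith)] at h1
  calc B * t ^ (-g) = B * B ^ g * (B ^ (-g) * t ^ (-g)) := by
        rw [Real.rpow_neg hB.le]
        have : B ^ g ≠ 0 := (Real.rpow_pos_of_pos hB g).ne'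
        field_simp
    _ ≤ _ := by gcongr

lemma le_mahlerExponent_two (hq : NotQuadratic ξ) (hg : 0 < g) (hB : 0 < B)
    (h : HasGoodPolynomials ξ g B) : (g : EReal) ≤ mahlerExponent 2 ξ := by
  refine coe_le_iSup_of_forall_lt hg fun w hw hwg => ?_
  refine infinite_of_forall_exists_lt (fun P => |aeval ξ P|) (fun P hP => hP.2.1) fun ε hε => ?_
  obtain ⟨t, ⟨ht, ht'⟩, ht1, P, hP, hdeg, hH, hle, -⟩ :=
    exists_eventually_of_hasGoodPolynomials h ((eventually_mul_rpow_neg_lt B hg hε).and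
      (eventually_mul_rpow_neg_le (A := B) hB hwg))
  have hHpos : 0 < polyHeight P := by linarith [one_le_polyHeight hP]
  exact ⟨P, ⟨hdeg, abs_pos.2 (hq.aeval_ne_zero hP hdeg), (hle.trans ht').trans
    (Real.rpow_le_rpow_of_nonpos hHpos hH (by linarith))⟩, hle.trans_lt ht⟩

/-- A good polynomial has a root α with |ξ − α| ≪ t^{-g-1}, and H(α) ≪ t because `intMinpoly α`
divides it. The margin w < g absorbs the constants, and since ξ is never such an α, distances
tending to 0 give infinitely many. -/
lemma le_koksmaExponent_two (hq : NotQuadratic ξ) (hg : 0 < g) (hB : 0 < B)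
    (h : HasGoodPolynomials ξ g B) : (g : EReal) ≤ koksmaExponent 2 ξ := by
  refine coe_le_iSup_of_forall_lt hg fun w hw hwg => ?_
  refine infinite_of_forall_exists_lt (fun α => ‖(ξ : ℂ) - α‖) ?_ fun ε hε => ?_
  · rintro α ⟨hα, hdeg, -⟩
    rw [norm_pos_iff, sub_ne_zero]
    rintro rfl
    have h1 := aeval_intMinpoly _ hα
    rw [show (ξ : ℂ) = algebraMap ℝ ℂ ξ from rfl, aeval_algebraMap_apply] at h1
    exact hq.aeval_ne_zero (intMinpoly_ne_zero _) ((natDegree_intMinpoly_le _).trans hdeg)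
      ((map_eq_zero_iff _ (algebraMap ℝ ℂ).injective).1 h1)
  · have hg1 : 0 < g + 1 := by linarith
    have hwg1 : w + 1 < g + 1 := by linarith
    have hB4 : 0 < 4 * B := by linarith
    obtain ⟨t, ⟨ht, ht'⟩, ht1, P, hP, hdeg, hH, hle, hder⟩ :=
      exists_eventually_of_hasGoodPolynomials h
        ((eventually_mul_rpow_neg_lt (4 * B * B) hg1 hε).and
          (eventually_mul_rpow_neg_le (A := 4 * B * B) hB4 hwg1))
    have ht0 : 0 < t := by linarith
    have hD : 0 < |aeval ξ (derivative P)| := by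
      have : 0 < B * |aeval ξ (derivative P)| := by linarith
      exact pos_of_mul_pos_right this hB.le
    obtain ⟨α, hα0, hαle⟩ := exists_root_near hdeg (hq.aeval_ne_zero hP hdeg) (abs_pos.1 hD)
    have hnear : ‖(ξ : ℂ) - α‖ ≤ 4 * B * B * t ^ (-(g + 1)) := by
      have h1 : ‖(ξ : ℂ) - α‖ * t ≤ 4 * B * B * t ^ (-g) := by
        calc ‖(ξ : ℂ) - α‖ * t ≤ ‖(ξ : ℂ) - α‖ * (B * |aeval ξ (derivative P)|) := by gcongr
          _ = B * (‖(ξ : ℂ) - α‖ * |aeval ξ (derivative P)|) := by ring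
          _ ≤ B * (4 * (B * t ^ (-g))) :=
              mul_le_mul_of_nonneg_left (hαle.trans (by gcongr)) hB.le
          _ = _ := by ring
      rw [neg_add, ← sub_eq_add_neg, Real.rpow_sub_one ht0.ne', ← mul_div_assoc,
        le_div_iff₀ ht0]
      exact h1
    have hdvd := intMinpoly_dvd hα0
    have hαalg : IsAlgebraic ℚ α :=
      (IsFractionRing.isAlgebraic_iff ℤ ℚ ℂ).1 ⟨P, hP, hα0⟩
    have hHα : algHeight α ≤ 4 * B * t := by
      have := polyHeight_le_of_dvd hP hdeg hdvd
      change polyHeight (intMinpoly α) ≤ _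
      linarith
    have hHpos : 0 < algHeight α :=
      zero_lt_one.trans_le (one_le_polyHeight (intMinpoly_ne_zero α))
    refine ⟨α, ⟨hαalg, ?_, ?_⟩, hnear.trans_lt ht⟩
    · have hmap : P.map (algebraMap ℤ ℚ) ≠ 0 :=
        (Polynomial.map_ne_zero_iff (algebraMap ℤ ℚ).injective_int).2 hP
      refine (natDegree_le_of_dvd (minpoly.dvd ℚ α ?_) hmap).trans
        (natDegree_map_le.trans hdeg)
      rw [aeval_map_algebraMap, hα0]
    · refine (hnear.trans ht').trans ?_
      rw [neg_add, ← sub_eq_add_neg]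
      exact Real.rpow_le_rpow_of_nonpos hHpos hHα (by linarith)

end Exponents

theorem mainTheorem9 (ξ : ℝ) (hξ : IsExtremal ξ) :
    (∃ c₁ c₂ : ℝ, 0 < c₁ ∧ 0 < c₂ ∧
      {P : ℤ[X] | P ≠ 0 ∧ P.natDegree ≤ 2 ∧
        |aeval ξ P| ≤ c₁ * polyHeight P ^ (-(Real.goldenRatio ^ 3))}.Infinite ∧
      ∀ P : ℤ[X], P ≠ 0 → P.natDegree ≤ 2 →
        c₂ * polyHeight P ^ (-(Real.goldenRatio ^ 3)) < |aeval ξ P|) ∧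
    mahlerExponent 2 ξ = ((Real.goldenRatio ^ 3 : ℝ) : EReal) ∧
    koksmaExponent 2 ξ = ((Real.goldenRatio ^ 3 : ℝ) : EReal) := by
  obtain ⟨hrank, c, hc, happrox⟩ := hξ
  have hq := notQuadratic_of_rank hrank
  obtain ⟨N, hN⟩ := exists_isMinSeq hq hc fun X hX => exists_simErr_le happrox hX
  obtain ⟨K, a, b, d, hK, hseq⟩ := hN.exists_isExtremalSeq hq
  obtain ⟨c₂, hc₂, hlow⟩ := hseq.exists_lower_bound hK
  obtain ⟨B, hB, hgood⟩ := hseq.exists_good_polynomial hK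
  have hg : 0 < Real.goldenRatio ^ 3 := pow_pos Real.goldenRatio_pos 3
  exact ⟨⟨B * B ^ (Real.goldenRatio ^ 3), c₂, mul_pos hB (Real.rpow_pos_of_pos hB _), hc₂,
      infinite_good_polynomials hq hg hB hgood, hlow⟩,
    le_antisymm (mahlerExponent_two_le hc₂ hlow) (le_mahlerExponent_two hq hg hB hgood),
    le_antisymm (koksmaExponent_two_le hg hc₂ hlow) (le_koksmaExponent_two hq hg hB hgood)⟩
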